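/- **Setting.** Let $\mathbf p=(p(j))_{j\ge 1}$ be a non-increasing sequence in $[0,\tfrac12]$, let $n\ge 1$, and let $X_1,\dots,X_n$ be i.i.d. samples of the product distribution on $\{0,1\}^{\mathbb N}$ whose $j$-th coordinate is Bernoulli with parameter $p(j)$. Write $\hat{\mathbf p}_n=\frac1n\sum_{i=1}^n X_i$ and $\|\hat{\mathbf p}_n-\mathbf p\|_\infty=\sup_{j\ge1}|\hat p_n(j)-p(j)|$. For real $J\ge 1$ and $q\in(0,\frac12]$ let $$\phi_{J,q}(n)=\begin{cases}1 & \text{if } n\le \frac{\ln(J+1)}{\ln(1/q)},\\[2pt] \dfrac{\ln(J+1)}{n\ln\frac{\ln(J+1)}{nq}} & \text{otherwise, if } n\le\frac{\ln(J+1)}{eq},\\[6pt] \sqrt{\dfrac{q\ln(J+1)}{n}} & \text{otherwise;}\end{cases}$$ for $J\in(0,1)$ let $\phi_{J,q}(n)=e^{-1/J}\sqrt{q/n}$; and let $\phi_{J,0}(n)=0$. **Proposition.** There are universal constants $a_1,a_2,c,C>0$ such that the following holds for all $n\ge1$, all $\gamma\in(0,\frac12)$ and all non-increasing sequences $\mathbf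 p$ in $[0,\frac12]$. 1. If there exists $j\ge1$ with $p(j)\ge\frac{\gamma}{2nj}$, then $$\mathbb P\Big(\|\hat{\mathbf p}_n-\mathbf p\|_\infty\ge a_1\sup_{j\ge1}\phi_{j/\gamma,\,p(j)}(n)\Big)\le\gamma \quad\text{and}\quad \mathbb P\Big(\max\big(\|\hat{\mathbf p}_n-\mathbf p\|_\infty,\tfrac1n\big)\le a_2\sup_{j\ge1}\phi_{j/\ln(1/\gamma),\,p(j)}(n)\Big)\le\gamma .$$ 2. If $p(j)\le\frac{\gamma}{2nj}$ for all $j\ge1$, then $$\mathbb P\Big(\sup_{j\ge1}\hat p_n(j)\ge\tfrac2n\Big)\le\gamma \quad\text{and}\quad c\,\min\Big(1,n\sum_{j\ge1}p(j)\Big)\le\mathbb P\Big(\sup_{j\ge1}\hat p_n(j)=\tfrac1n\Big)\le C\,\min\Big(1,n\sum_{j\ge1}p(j)\Big),$$ where the sum may be $+\infty$. -/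

import Mathlib

open MeasureTheory ProbabilityTheory

namespace LocalGC

/-- The product distribution on `{0,1}^ℕ` (coordinates `j = 1, 2, …`, with `true` standing for `1`
and `false` for `0`) whose coordinates are independent Bernoulli variables with parameters
`p 1, p 2, …`. -/
noncomputable def bernoulliProduct (p : ℕ+ → unitInterval) : Measure (ℕ+ → Bool) :=
  Measure.infinitePi fun j => bernoulliMeasure true false (p j)

/-- The sequences `p` with values in `[0, 1/2]` sorted in descending order. -/
def IsProfile (p : ℕ+ → unitInterval) : Prop :=
  Antitone p ∧ ∀ j, (p j : ℝ) ≤ 1 / 2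

/-- `X 0, …, X (n-1)` are i.i.d. samples, on the probability space `(Ω, P)`, of the product
Bernoulli distribution with parameters `p`. -/
structure IsSample {Ω : Type*} [MeasurableSpace Ω] (P : Measure Ω) (p : ℕ+ → unitInterval)
    {n : ℕ} (X : Fin n → Ω → ℕ+ → Bool) : Prop where
  hasLaw : ∀ i, HasLaw (X i) (bernoulliProduct p) P
  indep : iIndepFun X P

/-- The `j`-th coordinate of the empirical mean of the points `x 0, …, x (n-1)` of `{0,1}^ℕ`. -/
noncomputable def empMean {n : ℕ} (x : Fin n → ℕ+ → Bool) (j : ℕ+) : ℝ :=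
  (∑ i, if x i j then (1 : ℝ) else 0) / n

/-- The maximal deviation `sup_j |p̂ j - p j|` of the empirical mean `p̂` of `x` from `p`. -/
noncomputable def maxDev {n : ℕ} (x : Fin n → ℕ+ → Bool) (p : ℕ+ → unitInterval) : ℝ :=
  ⨆ j, |empMean x j - p j|

/-- The functional `φ_{J,q}(n)` for real `J > 0` and `q ∈ [0, 1/2]`. The three regimes of the case
`1 ≤ J` are read in order: a later one applies when the earlier ones do not. -/
noncomputable def phi (J q : ℝ) (n : ℕ) : ℝ :=
  if q = 0 then 0
  else if J < 1 then Real.exp (-1 / J) * Real.sqrt (q / n)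
  else if (n : ℝ) ≤ Real.log (J + 1) / Real.log (1 / q) then 1
  else if (n : ℝ) ≤ Real.log (J + 1) / (Real.exp 1 * q) then
    Real.log (J + 1) / (n * Real.log (Real.log (J + 1) / (n * q)))
  else Real.sqrt (q * Real.log (J + 1) / n)

end LocalGC

/-! The coordinate counts of a sample are independent binomials (`IsSample.hasLaw_count`), so every
claim reduces to binomial estimates for one coordinate.

Upper deviation: Chernoff's bound gives coordinate `j` a deviation above `8 * phi` with probability
at most `2 * (J + 1)⁻³` (`binMass_dev_le`). With `J = j / γ` the union bound costs at most a
multiple of `γ ^ 3 * ∑ 1 / j ^ 2`, which is below `γ`.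

Lower deviation: pick `j` nearly maximising `phi`. Coordinates `1, …, j` all have parameter at least
`p j`, and each stays within `phi / 1000` of its mean with probability at most `exp (-1 / J)`
(`binMass_near_le`). With `J = j / log (1 / γ)`, independence multiplies these `j` factors to `γ`.
For bounded `J` the one-coordinate bound is a small-ball estimate from weights of size `O(1 / √(n *
q))`. For large `J` it is a change of measure: a tilted parameter makes a large deviation likely, at
an entropy cost `n * bernoulliKL` that is a small multiple of `log (J + 1)` plus a constant
(`exp_le_binMass`).

Small parameters: a count of at least 2 is a second-order event, while by independence some count is
positive with probability comparable to `min 1 (n * ∑ p j)`. The difference of the two gives the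
lower bound for a maximal count of exactly 1. -/

namespace LocalGC

/-! ### Binomial sums, Markov, Chernoff and Chebyshev bounds -/

/-- The weight of `k` under the binomial distribution with parameters `n` and `q`. -/
noncomputable def binWeight (n : ℕ) (q : ℝ) (k : ℕ) : ℝ :=
  n.choose k * q ^ k * (1 - q) ^ (n - k)

/-- The mass of `A` under the binomial distribution with parameters `n` and `q`. -/
noncomputable def binMass (n : ℕ) (q : ℝ) (A : Set ℕ) : ℝ :=
  ∑ k ∈ Finset.range (n + 1), A.indicator (binWeight n q) k

lemma binWeight_nonneg {n : ℕ} {q : ℝ} (h0 : 0 ≤ q) (h1 : q ≤ 1) (k : ℕ) :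
    0 ≤ binWeight n q k := by
  have : 0 ≤ 1 - q := by linarith
  unfold binWeight; positivity

/-- Total mass, mean and variance then follow from the known identities for Bernstein polynomials.
-/
lemma binWeight_eq_eval (n : ℕ) (q : ℝ) (k : ℕ) :
    binWeight n q k = (bernsteinPolynomial ℝ n k).eval q := by
  simp [bernsteinPolynomial, binWeight]

lemma sum_binWeight (n : ℕ) (q : ℝ) : ∑ k ∈ Finset.range (n + 1), binWeight n q k = 1 := by
  have := congrArg (Polynomial.eval q) (bernsteinPolynomial.sum ℝ n)
  simpa [Polynomial.eval_finsetSum, binWeight_eq_eval] using this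

lemma sum_mul_binWeight (n : ℕ) (q : ℝ) :
    ∑ k ∈ Finset.range (n + 1), (k : ℝ) * binWeight n q k = n * q := by
  have := congrArg (Polynomial.eval q) (bernsteinPolynomial.sum_smul ℝ n)
  simpa [Polynomial.eval_finsetSum, binWeight_eq_eval] using this

lemma sum_sq_mul_binWeight (n : ℕ) (q : ℝ) :
    ∑ k ∈ Finset.range (n + 1), (n * q - k) ^ 2 * binWeight n q k = n * q * (1 - q) := by
  have := congrArg (Polynomial.eval q) (bernsteinPolynomial.variance ℝ n)
  simpa [Polynomial.eval_finsetSum, binWeight_eq_eval] using this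

lemma binMass_mono {n : ℕ} {q : ℝ} (h0 : 0 ≤ q) (h1 : q ≤ 1) {A B : Set ℕ}
    (h : ∀ k ≤ n, k ∈ A → k ∈ B) : binMass n q A ≤ binMass n q B := by
  refine Finset.sum_le_sum fun k hk => ?_
  have hk' : k ≤ n := by simpa [Nat.lt_succ_iff] using hk
  by_cases hA : k ∈ A
  · simp [hA, h k hk' hA]
  · simp only [hA, not_false_eq_true, Set.indicator_of_notMem]
    exact Set.indicator_nonneg (fun x _ => binWeight_nonneg h0 h1 x) k

lemma binMass_add_compl (n : ℕ) (q : ℝ) (A : Set ℕ) :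
    binMass n q A + binMass n q Aᶜ = 1 := by
  rw [binMass, binMass, ← Finset.sum_add_distrib, ← sum_binWeight n q]
  exact Finset.sum_congr rfl fun k _ => congrFun (Set.indicator_self_add_compl A _) k

lemma binMass_nonneg {n : ℕ} {q : ℝ} (h0 : 0 ≤ q) (h1 : q ≤ 1) (A : Set ℕ) :
    0 ≤ binMass n q A :=
  Finset.sum_nonneg fun k _ => Set.indicator_nonneg (fun x _ => binWeight_nonneg h0 h1 x) k

lemma binMass_le_one {n : ℕ} {q : ℝ} (h0 : 0 ≤ q) (h1 : q ≤ 1) (A : Set ℕ) :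
    binMass n q A ≤ 1 := by
  linarith [binMass_add_compl n q A, binMass_nonneg (n := n) h0 h1 Aᶜ]

lemma binMass_union_le {n : ℕ} {q : ℝ} (h0 : 0 ≤ q) (h1 : q ≤ 1) (A B : Set ℕ) :
    binMass n q (A ∪ B) ≤ binMass n q A + binMass n q B := by
  rw [binMass, binMass, binMass, ← Finset.sum_add_distrib]
  refine Finset.sum_le_sum fun k _ => ?_
  have := binWeight_nonneg (n := n) h0 h1 k
  by_cases hA : k ∈ A <;> by_cases hB : k ∈ B <;> simp [hA, hB, this]

/-- Markov's inequality for the binomial distribution. -/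
lemma binMass_le_sum {n : ℕ} {q : ℝ} (h0 : 0 ≤ q) (h1 : q ≤ 1) {A : Set ℕ} {f : ℕ → ℝ}
    (hf : ∀ k, 0 ≤ f k) (hA : ∀ k ∈ A, 1 ≤ f k) :
    binMass n q A ≤ ∑ k ∈ Finset.range (n + 1), f k * binWeight n q k := by
  refine Finset.sum_le_sum fun k _ => ?_
  have := binWeight_nonneg (n := n) h0 h1 k
  by_cases h : k ∈ A
  · simp only [h, Set.indicator_of_mem]
    nlinarith [hA k h]
  · simp only [h, not_false_eq_true, Set.indicator_of_notMem]
    exact mul_nonneg (hf k) this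

lemma sum_exp_mul_binWeight (n : ℕ) (q l : ℝ) :
    ∑ k ∈ Finset.range (n + 1), Real.exp (l * k) * binWeight n q k
      = (q * Real.exp l + (1 - q)) ^ n := by
  rw [add_pow]
  refine Finset.sum_congr rfl fun k _ => ?_
  rw [binWeight, mul_pow, ← Real.exp_nat_mul, mul_comm l]
  ring

/-- Chernoff's bound for the binomial distribution; `l` may have either sign. -/
lemma binMass_chernoff {n : ℕ} {q : ℝ} (h0 : 0 ≤ q) (h1 : q ≤ 1) (l m : ℝ) :
    binMass n q {k | l * m ≤ l * k} ≤ Real.exp (n * q * (Real.exp l - 1) - l * m) := by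
  have h := binMass_le_sum (n := n) h0 h1 (A := {k : ℕ | l * m ≤ l * k})
    (f := fun k => Real.exp (-(l * m)) * Real.exp (l * k)) (fun k => by positivity) (by
      intro k hk
      have hk : l * m ≤ l * k := hk
      rw [← Real.exp_add]
      exact Real.one_le_exp (by linarith))
  simp only [mul_assoc, ← Finset.mul_sum] at h
  rw [sum_exp_mul_binWeight] at h
  refine h.trans ?_
  have h2 : (q * Real.exp l + (1 - q)) ^ n ≤ Real.exp (n * q * (Real.exp l - 1)) := by
    rw [mul_assoc, Real.exp_nat_mul]
    refine pow_le_pow_left₀ ?_ ?_ n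
    · have := Real.exp_pos l
      have : 0 ≤ 1 - q := by linarith
      positivity
    · have := Real.add_one_le_exp (q * (Real.exp l - 1))
      linarith
  calc _ ≤ Real.exp (-(l * m)) * Real.exp (n * q * (Real.exp l - 1)) := by gcongr
    _ = _ := by rw [← Real.exp_add]; congr 1; ring

/-- Chebyshev's inequality for the lower tail of the binomial distribution. -/
lemma binMass_lower_tail_le {n : ℕ} {q s : ℝ} (h0 : 0 ≤ q) (h1 : q ≤ 1) (hs : 0 < s) :
    binMass n q {k | (k : ℝ) ≤ n * q - s} ≤ n * q / s ^ 2 := by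
  have h := binMass_le_sum (n := n) h0 h1 (A := {k : ℕ | (k : ℝ) ≤ n * q - s})
    (f := fun k => (1 / s ^ 2) * (n * q - k) ^ 2) (fun k => by positivity) (by
      intro k hk
      have hk : (k : ℝ) ≤ n * q - s := hk
      rw [one_div, ← div_eq_inv_mul, le_div_iff₀ (by positivity)]
      nlinarith)
  simp only [mul_assoc, ← Finset.mul_sum] at h
  rw [sum_sq_mul_binWeight] at h
  refine h.trans ?_
  rw [div_mul_eq_mul_div, one_mul]
  refine div_le_div_of_nonneg_right ?_ (by positivity)
  have : 0 ≤ (n : ℝ) * q := by positivity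
  nlinarith

/-! ### Pointwise bounds on the weights and the small-ball estimate -/

lemma binWeight_succ (n : ℕ) (q : ℝ) (k : ℕ) :
    binWeight n q (k + 1) * ((k + 1) * (1 - q)) = binWeight n q k * ((n - k) * q) := by
  rcases lt_trichotomy k n with h | rfl | h
  · obtain ⟨d, rfl⟩ : ∃ d, n = k + 1 + d := ⟨n - (k + 1), by omega⟩
    have hc : (((k + 1 + d).choose (k + 1) : ℕ) : ℝ) * (k + 1)
        = ((k + 1 + d).choose k : ℕ) * (((k + 1 + d : ℕ) : ℝ) - k) := by
      have := Nat.choose_succ_right_eq (k + 1 + d) k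
      have h3 : k + 1 + d - k = d + 1 := by omega
      rw [h3] at this
      have h4 : (((k + 1 + d).choose (k + 1) : ℕ) : ℝ) * ((k : ℝ) + 1)
        = ((k + 1 + d).choose k : ℕ) * ((d : ℝ) + 1) := by exact_mod_cast this
      rw [h4]; push_cast; ring
    have e1 : k + 1 + d - (k + 1) = d := by omega
    have e2 : k + 1 + d - k = d + 1 := by omega
    rw [binWeight, binWeight, e1, e2, pow_succ, pow_succ]
    linear_combination (q ^ k * q * (1 - q) ^ d * (1 - q)) * hc
  · simp [binWeight]
  · simp [binWeight, Nat.choose_eq_zero_of_lt h, Nat.choose_eq_zero_of_lt (Nat.lt_succ_of_lt h)]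

lemma binWeight_symm {n : ℕ} (q : ℝ) {k : ℕ} (hk : k ≤ n) :
    binWeight n q k = binWeight n (1 - q) (n - k) := by
  rw [binWeight, binWeight, Nat.choose_symm hk, Nat.sub_sub_self hk]
  ring

/-- At or below the mean, the ratio of consecutive weights at step `i` is at least `1 - (i + 1) /
v`, with `v` the variance. The product of these factors is at least `1 - i ^ 2 / v`, so the weights
stay comparable over about `√v` steps to the right. -/
lemma binWeight_add_ge {n : ℕ} {q : ℝ} (h0 : 0 < q) (h1 : q < 1) (hn : 0 < n) {k : ℕ}
    (hk : (k : ℝ) ≤ n * q) (i : ℕ) :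
    binWeight n q k * (1 - i ^ 2 / (n * q * (1 - q))) ≤ binWeight n q (k + i) := by
  have hq' : 0 < 1 - q := by linarith
  have hn' : (0 : ℝ) < n := by exact_mod_cast hn
  set v := n * q * (1 - q) with hv
  have hvpos : 0 < v := by positivity
  have hb := binWeight_nonneg (n := n) h0.le h1.le
  induction i with
  | zero => simp
  | succ i ih =>
    -- If `v ≤ i + 1` the left side is nonpositive; otherwise `1 - (i + 1) / v` is positive and can
    -- multiply the induction hypothesis.
    rcases le_or_gt v ((i + 1 : ℝ)) with hvi | hvi
    · have : 1 - ((i + 1 : ℕ) : ℝ) ^ 2 / v ≤ 0 := by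
        rw [sub_nonpos, le_div_iff₀ hvpos, one_mul]
        push_cast
        nlinarith [(Nat.cast_nonneg i : (0 : ℝ) ≤ i)]
      exact (mul_nonpos_of_nonneg_of_nonpos (hb k) this).trans (hb _)
    · have hi0 : (0 : ℝ) ≤ i := Nat.cast_nonneg i
      have hrec := binWeight_succ n q (k + i)
      have hstep : binWeight n q (k + i) * (1 - (i + 1) / v) ≤ binWeight n q (k + i + 1) := by
        have hpos : 0 < ((k + i : ℕ) + 1 : ℝ) * (1 - q) := by positivity
        refine le_of_mul_le_mul_right ?_ hpos
        rw [hrec, mul_assoc]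
        refine mul_le_mul_of_nonneg_left ?_ (hb _)
        have hc : 0 ≤ 1 - (i + 1) / v := by
          rw [sub_nonneg, div_le_one hvpos]; exact hvi.le
        have e1 : ((k + i : ℕ) + 1 : ℝ) * (1 - q) ≤ v + (i + 1) * (1 - q) := by
          push_cast
          nlinarith
        have e2 : v - i * q ≤ ((n : ℝ) - (k + i : ℕ)) * q := by
          push_cast
          nlinarith
        have e3 : (1 - (i + 1) / v) * (v + (i + 1) * (1 - q)) ≤ v - i * q := by
          have : (1 - (i + 1) / v) * (v + (i + 1) * (1 - q))
              = v - (i + 1) * q - (i + 1) ^ 2 * (1 - q) / v := by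
            field_simp; ring
          rw [this]
          have : 0 ≤ ((i : ℝ) + 1) ^ 2 * (1 - q) / v := by positivity
          nlinarith
        calc _ ≤ (1 - (i + 1) / v) * (v + (i + 1) * (1 - q)) :=
              mul_le_mul_of_nonneg_left e1 hc
          _ ≤ _ := e3.trans e2
      have hc : 0 ≤ 1 - ((i : ℝ) + 1) / v := by
        rw [sub_nonneg, div_le_one hvpos]; exact hvi.le
      have e4 : 1 - ((i + 1 : ℕ) : ℝ) ^ 2 / v ≤ (1 - (i : ℝ) ^ 2 / v) * (1 - (i + 1) / v) := by
        have : (1 - (i : ℝ) ^ 2 / v) * (1 - (i + 1) / v)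
          = 1 - ((i : ℝ) ^ 2 + i + 1) / v + (i : ℝ) ^ 2 * (i + 1) / v ^ 2 := by
          field_simp; ring
        rw [this]
        have h5 : ((i : ℝ) ^ 2 + i + 1) / v ≤ ((i + 1 : ℕ) : ℝ) ^ 2 / v := by
          gcongr
          push_cast; nlinarith
        have : 0 ≤ (i : ℝ) ^ 2 * (i + 1) / v ^ 2 := by positivity
        linarith
      calc _ ≤ binWeight n q k * ((1 - (i : ℝ) ^ 2 / v) * (1 - (i + 1) / v)) :=
            mul_le_mul_of_nonneg_left e4 (hb _)
        _ ≤ binWeight n q (k + i) * (1 - (i + 1) / v) := by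
            rw [← mul_assoc]; exact mul_le_mul_of_nonneg_right ih hc
        _ ≤ _ := hstep

lemma binWeight_eq_zero {n k : ℕ} (q : ℝ) (h : n < k) : binWeight n q k = 0 := by
  simp [binWeight, Nat.choose_eq_zero_of_lt h]

lemma sum_binWeight_le_one {n : ℕ} {q : ℝ} (h0 : 0 ≤ q) (h1 : q ≤ 1) (s : Finset ℕ) :
    ∑ k ∈ s, binWeight n q k ≤ 1 := by
  rw [← sum_binWeight n q, ← Finset.sum_filter_add_sum_filter_not s (fun k => k ≤ n)]
  rw [Finset.sum_eq_zero (s := s.filter fun k => ¬ k ≤ n), add_zero]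
  · refine Finset.sum_le_sum_of_subset_of_nonneg ?_ fun k _ _ => binWeight_nonneg h0 h1 k
    intro k hk
    simp at hk ⊢
    omega
  · intro k hk
    exact binWeight_eq_zero q (by simpa using (Finset.mem_filter.1 hk).2)

/-- More than `√(v / 2)` consecutive weights starting at `k` are each at least half the weight of
`k`, and together they have mass at most 1. -/
lemma binWeight_le_of_le_mean {n : ℕ} {q : ℝ} (h0 : 0 < q) (h1 : q < 1) (hn : 0 < n) {k : ℕ}
    (hk : (k : ℝ) ≤ n * q) : binWeight n q k * √(n * q * (1 - q)) ≤ 2 * √2 := by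
  have hq' : 0 < 1 - q := by linarith
  have hn' : (0 : ℝ) < n := by exact_mod_cast hn
  have hmain := binWeight_add_ge h0 h1 hn hk
  set v := n * q * (1 - q) with hv
  have hvpos : 0 < v := by positivity
  have hb := binWeight_nonneg (n := n) h0.le h1.le
  set w := ⌊√(v / 2)⌋₊ with hw
  have hs : ∑ i ∈ Finset.range (w + 1), binWeight n q k * (1 / 2)
      ≤ ∑ i ∈ Finset.range (w + 1), binWeight n q (k + i) := by
    refine Finset.sum_le_sum fun i hi => le_trans ?_ (hmain i)
    refine mul_le_mul_of_nonneg_left ?_ (hb _)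
    have hi' : (i : ℝ) ≤ √(v / 2) := by
      refine le_trans ?_ (Nat.floor_le (Real.sqrt_nonneg _))
      have : i ≤ w := by simpa [Nat.lt_succ_iff] using hi
      exact_mod_cast this
    have h2 : (i : ℝ) ^ 2 ≤ v / 2 := by
      calc (i : ℝ) ^ 2 ≤ √(v / 2) ^ 2 := by gcongr
        _ = v / 2 := Real.sq_sqrt (by positivity)
    have : (i : ℝ) ^ 2 / v ≤ 1 / 2 := by
      rw [div_le_iff₀ hvpos]; linarith
    linarith
  have hs2 : ∑ i ∈ Finset.range (w + 1), binWeight n q (k + i) ≤ 1 := by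
    have := sum_binWeight_le_one (n := n) h0.le h1.le
      ((Finset.range (w + 1)).map (addLeftEmbedding k))
    simpa using this
  have hs3 := hs.trans hs2
  simp only [Finset.sum_const, Finset.card_range, nsmul_eq_mul] at hs3
  have hfl : √(v / 2) ≤ ((w + 1 : ℕ) : ℝ) := by
    push_cast; exact (Nat.lt_floor_add_one _).le
  have hsq : √v = √2 * √(v / 2) := by
    rw [← Real.sqrt_mul (by norm_num)]; congr 1; ring
  rw [hsq]
  have : binWeight n q k * √(v / 2) ≤ 2 := by nlinarith [hb k]
  nlinarith [Real.sqrt_nonneg 2]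

/-- The binomial weights are at most of the order of the inverse standard deviation. -/
lemma binWeight_mul_sqrt_le {n : ℕ} {q : ℝ} (h0 : 0 < q) (h1 : q ≤ 1 / 2) (k : ℕ) :
    binWeight n q k * √(n * q) ≤ 4 := by
  rcases Nat.eq_zero_or_pos n with rfl | hn
  · simp
  have hn' : (0 : ℝ) < n := by exact_mod_cast hn
  have hb := binWeight_nonneg (n := n) h0.le (by linarith : q ≤ 1)
  have key : binWeight n q k * √(n * q * (1 - q)) ≤ 2 * √2 := by
    rcases le_total (k : ℝ) (n * q) with h | h
    · exact binWeight_le_of_le_mean h0 (by linarith) hn h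
    -- Above the mean, exchanging successes and failures reduces to the case below the mean.
    · rcases le_or_gt k n with hkn | hkn
      · rw [binWeight_symm q hkn]
        have := binWeight_le_of_le_mean (q := 1 - q) (by linarith) (by linarith) hn (k := n - k)
          (by push_cast [hkn]; linarith)
        rwa [show (n : ℝ) * (1 - q) * (1 - (1 - q)) = n * q * (1 - q) by ring] at this
      · rw [binWeight_eq_zero q hkn]; simp
  have h3 : √(n * q) ≤ √2 * √(n * q * (1 - q)) := by
    rw [← Real.sqrt_mul (by norm_num)]
    apply Real.sqrt_le_sqrt
    have : 0 < n * q := by positivity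
    nlinarith
  have h2 : √2 * √2 = 2 := Real.mul_self_sqrt (by norm_num)
  calc _ ≤ binWeight n q k * (√2 * √(n * q * (1 - q))) := mul_le_mul_of_nonneg_left h3 (hb k)
    _ = √2 * (binWeight n q k * √(n * q * (1 - q))) := by ring
    _ ≤ √2 * (2 * √2) := by gcongr
    _ = 4 := by linarith

/-- Small-ball estimate for the binomial distribution. -/
lemma binMass_abs_sub_le {n : ℕ} {q T : ℝ} (h0 : 0 < q) (h1 : q ≤ 1 / 2) (hn : 0 < n)
    (hT : 1 ≤ T) (c : ℝ) : binMass n q {k | |(k : ℝ) - c| ≤ T} ≤ 12 * T / √(n * q) := by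
  have hn' : (0 : ℝ) < n := by exact_mod_cast hn
  have hsq : 0 < √(n * q) := Real.sqrt_pos.2 (by positivity)
  have hw : ∀ k, binWeight n q k ≤ 4 / √(n * q) := fun k => by
    rw [le_div_iff₀ hsq]; exact binWeight_mul_sqrt_le h0 h1 k
  classical
  set s := (Finset.range (n + 1)).filter fun k : ℕ => |(k : ℝ) - c| ≤ T with hs
  have hm : binMass n q {k | |(k : ℝ) - c| ≤ T} = ∑ k ∈ s, binWeight n q k := by
    rw [binMass, Finset.sum_filter]
    exact Finset.sum_congr rfl fun k _ => by simp [Set.indicator_apply]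
  -- An interval of length `2 * T` holds at most `2 * T + 1` integers, and `1 ≤ T`.
  have hcard : (s.card : ℝ) ≤ 3 * T := by
    have hsub : s.map Nat.castEmbedding ⊆ Finset.Icc ⌈c - T⌉ ⌊c + T⌋ := by
      intro z hz
      simp only [Finset.mem_map, hs, Finset.mem_filter, Finset.mem_Icc] at hz ⊢
      obtain ⟨k, ⟨_, hk⟩, rfl⟩ := hz
      rw [abs_le] at hk
      constructor
      · refine Int.ceil_le.2 ?_
        simp; linarith
      · refine Int.le_floor.2 ?_
        simp; linarith
    have hc := Finset.card_le_card hsub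
    rw [Finset.card_map, Int.card_Icc] at hc
    have h5 : (s.card : ℤ) ≤ max (⌊c + T⌋ + 1 - ⌈c - T⌉) 0 := by
      rw [← Int.ofNat_toNat]; exact_mod_cast hc
    have h6 : (s.card : ℝ) ≤ max ((⌊c + T⌋ : ℝ) + 1 - ⌈c - T⌉) 0 := by exact_mod_cast h5
    refine h6.trans (max_le ?_ (by linarith))
    linarith [Int.floor_le (c + T), Int.le_ceil (c - T)]
  rw [hm]
  calc ∑ k ∈ s, binWeight n q k ≤ ∑ k ∈ s, 4 / √(n * q) := Finset.sum_le_sum fun k _ => hw k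
    _ = s.card * (4 / √(n * q)) := by simp
    _ ≤ 3 * T * (4 / √(n * q)) := by gcongr
    _ = _ := by ring

/-! ### Relative entropy and change of measure -/

/-- The relative entropy of the Bernoulli distribution with parameter `r` with respect to the one
with parameter `q`. -/
noncomputable def bernoulliKL (r q : ℝ) : ℝ :=
  r * Real.log (r / q) + (1 - r) * Real.log ((1 - r) / (1 - q))

/-- Change of measure: an event that is likely under the parameter `r` has a probability under
the parameter `q` that is controlled by the relative entropy. -/
lemma exp_le_binMass {n : ℕ} {q r : ℝ} (hq0 : 0 < q) (hq1 : q < 1) (hr0 : 0 < r) (hr1 : r < 1)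
    {A : Set ℕ} (hA : 1 / 2 ≤ binMass n r A) :
    Real.exp (-(2 * (n * bernoulliKL r q) + 3)) ≤ binMass n q A := by
  set D := n * bernoulliKL r q with hD
  -- Chosen so that `(1 + m) / 2 - D - 1 = 1`, which makes the final bracket at least 1.
  set m := 2 * D + 3 with hm
  set Λ : ℕ → ℝ := fun k => k * Real.log (r / q) + (n - k) * Real.log ((1 - r) / (1 - q)) with hΛ
  have hq1' : 0 < 1 - q := by linarith
  have hr1' : 0 < 1 - r := by linarith
  have hratio : ∀ k ∈ Finset.range (n + 1),
      binWeight n q k = binWeight n r k * Real.exp (-Λ k) := by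
    intro k hk
    have hk' : k ≤ n := by simpa [Nat.lt_succ_iff] using hk
    have e : Real.exp (-Λ k) = (q / r) ^ k * ((1 - q) / (1 - r)) ^ (n - k) := by
      have h1 : -Λ k = k * Real.log (q / r) + (n - k : ℕ) * Real.log ((1 - q) / (1 - r)) := by
        rw [← inv_div r q, ← inv_div (1 - r), Real.log_inv, Real.log_inv, Nat.cast_sub hk']
        simp only [hΛ]; ring
      rw [h1, Real.exp_add, Real.exp_nat_mul, Real.exp_nat_mul, Real.exp_log (by positivity),
        Real.exp_log (by positivity)]
    rw [e, binWeight, binWeight, div_pow, div_pow]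
    field_simp
  have hsumΛ : ∑ k ∈ Finset.range (n + 1), binWeight n r k * Λ k = D := by
    have : ∀ k, binWeight n r k * Λ k = Real.log (r / q) * (k * binWeight n r k)
        + Real.log ((1 - r) / (1 - q)) * (n * binWeight n r k - k * binWeight n r k) := by
      intro k; simp only [hΛ]; ring
    simp only [this, Finset.sum_add_distrib, ← Finset.mul_sum, Finset.sum_sub_distrib,
      sum_mul_binWeight, sum_binWeight, hD, bernoulliKL]
    ring
  -- Linearising `exp` at `m` on `A` and at `0` off `A` means that only the mean `D` of the
  -- log-likelihood ratio `Λ` enters after summation, and no concentration of `Λ` is needed.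
  have hpt : ∀ k ∈ Finset.range (n + 1),
      Real.exp (-m) * ((1 + m) * A.indicator (binWeight n r) k - binWeight n r k * Λ k
        - Aᶜ.indicator (binWeight n q) k) ≤ A.indicator (binWeight n q) k := by
    intro k hk
    have hwr := binWeight_nonneg (n := n) hr0.le hr1.le k
    have hwq := binWeight_nonneg (n := n) hq0.le hq1.le k
    by_cases hkA : k ∈ A
    · simp only [hkA, Set.indicator_of_mem, Set.mem_compl_iff, not_true_eq_false,
        not_false_eq_true, Set.indicator_of_notMem]
      rw [hratio k hk]
      have h1 : Real.exp (-m) * (1 + m - Λ k) ≤ Real.exp (-Λ k) := by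
        have := Real.add_one_le_exp (m - Λ k)
        calc _ ≤ Real.exp (-m) * Real.exp (m - Λ k) := by gcongr; linarith
          _ = _ := by rw [← Real.exp_add]; congr 1; ring
      nlinarith
    · simp only [hkA, Set.indicator_of_mem, Set.mem_compl_iff,
        not_false_eq_true, Set.indicator_of_notMem]
      have h1 : -(binWeight n r k * Λ k) ≤ binWeight n q k := by
        rw [hratio k hk]
        nlinarith [Real.add_one_le_exp (-Λ k)]
      have := Real.exp_pos (-m)
      nlinarith
  have hsum := Finset.sum_le_sum hpt
  rw [← Finset.mul_sum, Finset.sum_sub_distrib, Finset.sum_sub_distrib, ← Finset.mul_sum,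
    hsumΛ] at hsum
  change Real.exp (-m) * ((1 + m) * binMass n r A - D - binMass n q Aᶜ) ≤ binMass n q A at hsum
  refine le_trans ?_ hsum
  have hc := binMass_le_one (n := n) hq0.le hq1.le Aᶜ
  have hDn : 0 ≤ 1 + m := by
    have : -1 ≤ D := by
      have h5 : ∑ k ∈ Finset.range (n + 1), (binWeight n r k - binWeight n q k) ≤
          ∑ k ∈ Finset.range (n + 1), binWeight n r k * Λ k := by
        refine Finset.sum_le_sum fun k hk => ?_
        rw [hratio k hk]
        nlinarith [Real.add_one_le_exp (-Λ k), binWeight_nonneg (n := n) hr0.le hr1.le k]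
      rw [Finset.sum_sub_distrib, sum_binWeight, sum_binWeight, hsumΛ] at h5
      linarith
    rw [hm]; linarith
  have : 1 ≤ (1 + m) * binMass n r A - D - binMass n q Aᶜ := by nlinarith
  nlinarith [Real.exp_pos (-m)]

/-- Applying `log x ≤ x - 1` to both logarithms gives the chi-square divergence. This serves the
Gaussian regime; `bernoulliKL_le_mul_log` serves parameters `r` far above `q`. -/
lemma bernoulliKL_le_sq {r q : ℝ} (hq0 : 0 < q) (hq1 : q < 1) (hr0 : 0 < r) (hr1 : r < 1) :
    bernoulliKL r q ≤ (r - q) ^ 2 / (q * (1 - q)) := by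
  have hq1' : 0 < 1 - q := by linarith
  have hr1' : 0 < 1 - r := by linarith
  have h1 := Real.log_le_sub_one_of_pos (show 0 < r / q by positivity)
  have h2 := Real.log_le_sub_one_of_pos (show 0 < (1 - r) / (1 - q) by positivity)
  calc bernoulliKL r q ≤ r * (r / q - 1) + (1 - r) * ((1 - r) / (1 - q) - 1) := by
        unfold bernoulliKL; gcongr
    _ = _ := by field_simp; ring

lemma bernoulliKL_le_mul_log {r q : ℝ} (hq1 : q < 1) (hqr : q ≤ r) (hr1 : r < 1) :
    bernoulliKL r q ≤ r * Real.log (r / q) := by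
  have hq1' : 0 < 1 - q := by linarith
  have hr1' : 0 < 1 - r := by linarith
  have h2 : Real.log ((1 - r) / (1 - q)) ≤ 0 :=
    Real.log_nonpos (by positivity) (by rw [div_le_one hq1']; linarith)
  unfold bernoulliKL
  nlinarith

/-! ### Properties of the functional `phi` -/

/-- The three regimes of `phi J q n` for `1 ≤ J`. -/
lemma phi_cases {J q : ℝ} {n : ℕ} (hJ : 1 ≤ J) (hq0 : 0 < q) (hq1 : q ≤ 1 / 2) :
    (n * Real.log (1 / q) ≤ Real.log (J + 1) ∧ phi J q n = 1) ∨
    (Real.log (J + 1) < n * Real.log (1 / q) ∧ Real.exp 1 * (n * q) ≤ Real.log (J + 1) ∧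
      phi J q n = Real.log (J + 1) / (n * Real.log (Real.log (J + 1) / (n * q)))) ∨
    (Real.log (J + 1) < Real.exp 1 * (n * q) ∧ phi J q n = √(q * Real.log (J + 1) / n)) := by
  have hlog : 0 < Real.log (1 / q) := Real.log_pos (by rw [lt_div_iff₀ hq0]; linarith)
  have he := Real.exp_pos 1
  unfold phi
  rw [if_neg hq0.ne', if_neg hJ.not_gt]
  by_cases h1 : (n : ℝ) ≤ Real.log (J + 1) / Real.log (1 / q)
  · rw [if_pos h1]
    exact Or.inl ⟨(le_div_iff₀ hlog).1 h1, rfl⟩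
  · rw [if_neg h1]
    rw [not_le, div_lt_iff₀ hlog] at h1
    by_cases h2 : (n : ℝ) ≤ Real.log (J + 1) / (Real.exp 1 * q)
    · rw [if_pos h2]
      rw [le_div_iff₀ (by positivity)] at h2
      exact Or.inr (Or.inl ⟨h1, by linarith, rfl⟩)
    · rw [if_neg h2]
      rw [not_le, div_lt_iff₀ (by positivity)] at h2
      exact Or.inr (Or.inr ⟨by linarith, rfl⟩)

lemma phi_zero_right (J : ℝ) (n : ℕ) : phi J 0 n = 0 := by simp [phi]

lemma one_le_log_div {L q : ℝ} {n : ℕ} (hq0 : 0 < q) (hn : 0 < n)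
    (h : Real.exp 1 * (n * q) ≤ L) : 1 ≤ Real.log (L / (n * q)) := by
  have hn' : (0 : ℝ) < n := by exact_mod_cast hn
  have : 0 < L := lt_of_lt_of_le (by positivity) h
  rw [Real.le_log_iff_exp_le (by positivity), le_div_iff₀ (by positivity)]
  exact h

lemma log_add_one_pos {J : ℝ} (hJ : 1 ≤ J) : 0 < Real.log (J + 1) :=
  Real.log_pos (by linarith)

lemma phi_pos {J q : ℝ} {n : ℕ} (hJ : 1 ≤ J) (hq0 : 0 < q) (hq1 : q ≤ 1 / 2) (hn : 0 < n) :
    0 < phi J q n := by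
  have hL := log_add_one_pos hJ
  have hn' : (0 : ℝ) < n := by exact_mod_cast hn
  rcases phi_cases hJ hq0 hq1 (n := n) with ⟨_, h⟩ | ⟨_, h2, h⟩ | ⟨_, h⟩ <;> rw [h]
  · exact one_pos
  · have := one_le_log_div hq0 hn h2
    positivity
  · positivity

/-- This bounds the family whose real supremum is taken, so that the supremum is a genuine upper
bound. -/
lemma phi_le_one {J q : ℝ} {n : ℕ} (hJ : 0 < J) (hq0 : 0 ≤ q) (hq1 : q ≤ 1 / 2) (hn : 0 < n) :
    phi J q n ≤ 1 := by
  have hn' : (1 : ℝ) ≤ n := by exact_mod_cast hn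
  rcases hq0.eq_or_lt with rfl | hq0
  · simp [phi]
  rcases lt_or_ge J 1 with hJ1 | hJ1
  · unfold phi
    rw [if_neg hq0.ne', if_pos hJ1]
    have h1 : Real.exp (-1 / J) ≤ 1 := Real.exp_le_one_iff.2 (by
      rw [div_nonpos_iff]; right; constructor <;> linarith)
    have h2 : √(q / n) ≤ 1 := Real.sqrt_le_one.2 (by rw [div_le_one (by linarith)]; linarith)
    have := Real.exp_pos (-1 / J)
    nlinarith [Real.sqrt_nonneg (q / n)]
  have hL := log_add_one_pos hJ1
  rcases phi_cases hJ1 hq0 hq1 (n := n) with ⟨_, h⟩ | ⟨h1, h2, h⟩ | ⟨h2, h⟩ <;> rw [h]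
  · have hl := one_le_log_div hq0 hn h2
    set L := Real.log (J + 1)
    rw [div_le_one (by positivity)]
    rcases le_total L n with hLn | hLn
    · nlinarith
    -- When `n ≤ L`, the denominator is at least `n * log (1 / q)`, which exceeds `L` because the
    -- first regime fails.
    · have : Real.log (1 / q) ≤ Real.log (L / (n * q)) := by
        apply Real.log_le_log (by positivity)
        rw [div_le_div_iff₀ hq0 (by positivity)]
        nlinarith
      nlinarith
  · rw [Real.sqrt_le_one, div_le_one (by linarith)]
    have he : Real.exp 1 < 3 := Real.exp_one_lt_three
    have h3 : Real.log (J + 1) ≤ 3 * (n * q) := by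
      have : 0 < n * q := by positivity
      nlinarith
    have : q * Real.log (J + 1) ≤ q * (3 * (n * q)) := by gcongr
    nlinarith [mul_nonneg (by linarith : (0:ℝ) ≤ n) (by nlinarith : 0 ≤ 1 / 4 - q * q)]

/-- In the first two regimes, `phi` inverts `t ↦ t * log (t / q)` up to constants. -/
lemma phi_mul_log_le {J q : ℝ} {n : ℕ} (hJ : 1 ≤ J) (hq0 : 0 < q) (hq1 : q ≤ 1 / 2) (hn : 0 < n)
    (h : phi J q n ≠ √(q * Real.log (J + 1) / n)) :
    n * (phi J q n * Real.log (phi J q n / q)) ≤ Real.log (J + 1) ∧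
      n * phi J q n ≤ 2 * Real.log (J + 1) := by
  have hL := log_add_one_pos hJ
  have hn' : (0 : ℝ) < n := by exact_mod_cast hn
  rcases phi_cases hJ hq0 hq1 (n := n) with ⟨h1, e⟩ | ⟨h1, h2, e⟩ | ⟨h2, e⟩
  · rw [e]
    refine ⟨by simpa using h1, ?_⟩
    have h3 : Real.log 2 ≤ Real.log (1 / q) :=
      Real.log_le_log (by norm_num) (by rw [le_div_iff₀ hq0]; linarith)
    have := Real.log_two_gt_d9
    nlinarith
  · have hl := one_le_log_div hq0 hn h2
    have hp := phi_pos hJ hq0 hq1 hn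
    set L := Real.log (J + 1)
    set y := Real.log (L / (n * q))
    have hle : n * phi J q n ≤ L := by
      rw [e, mul_div_assoc', div_le_iff₀ (by positivity)]
      have := mul_le_mul_of_nonneg_left hl (by positivity : 0 ≤ n * L)
      nlinarith
    have heq : n * phi J q n * y = L := by rw [e]; field_simp
    refine ⟨?_, by linarith⟩
    have : Real.log (phi J q n / q) ≤ y := by
      apply Real.log_le_log (by positivity)
      rw [div_le_div_iff₀ hq0 (by positivity)]
      nlinarith
    calc n * (phi J q n * Real.log (phi J q n / q)) ≤ n * (phi J q n * y) := by gcongr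
      _ = L := by rw [← heq]; ring
  · exact absurd e h

/-! ### Tail bound for one coordinate -/

/-- Deviation bound for one coordinate. -/
lemma binMass_dev_le {J q : ℝ} {n : ℕ} (hJ : 1 ≤ J) (hq0 : 0 < q) (hq1 : q ≤ 1 / 2)
    (hn : 0 < n) :
    binMass n q {k | 8 * phi J q n < |(k : ℝ) / n - q|} ≤
      2 * Real.exp (-(3 * Real.log (J + 1))) := by
  have hL := log_add_one_pos hJ
  have hn' : (0 : ℝ) < n := by exact_mod_cast hn
  have hp := phi_pos hJ hq0 hq1 hn
  have hc := phi_cases hJ hq0 hq1 (n := n)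
  set L := Real.log (J + 1)
  set t := phi J q n
  have hexp := Real.exp_pos (-(3 * L))
  have hq1' : q ≤ 1 := by linarith
  have hsub : binMass n q {k | 8 * t < |(k : ℝ) / n - q|} ≤
      binMass n q {k : ℕ | k ≤ n ∧ n * (q + 8 * t) ≤ k}
        + binMass n q {k : ℕ | (k : ℝ) ≤ n * (q - 8 * t)} := by
    refine le_trans (binMass_mono hq0.le hq1' ?_) (binMass_union_le hq0.le hq1' _ _)
    intro k hkn hk
    have hk : 8 * t < |(k : ℝ) / n - q| := hk
    rcases lt_abs.1 hk with h | h
    · left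
      refine ⟨hkn, ?_⟩
      have : q + 8 * t ≤ k / n := by linarith
      rw [le_div_iff₀ hn'] at this
      linarith
    · right
      have : (k : ℝ) / n ≤ q - 8 * t := by linarith
      rw [div_le_iff₀ hn'] at this
      simp only [Set.mem_ofPred_eq]
      linarith
  have hempty : q < 8 * t → binMass n q {k : ℕ | (k : ℝ) ≤ n * (q - 8 * t)} ≤ 0 := by
    intro h
    have : {k : ℕ | (k : ℝ) ≤ n * (q - 8 * t)} = ∅ := by
      ext k
      simp only [Set.mem_ofPred_eq, Set.mem_empty_iff_false, iff_false, not_le]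
      have : (0 : ℝ) ≤ k := Nat.cast_nonneg k
      nlinarith
    rw [this]; simp [binMass]
  rcases hc with ⟨_, e⟩ | ⟨h1, h2, e⟩ | ⟨h2, e⟩
  · have h1 : binMass n q {k : ℕ | k ≤ n ∧ n * (q + 8 * t) ≤ k} ≤ 0 := by
      have : {k : ℕ | k ≤ n ∧ n * (q + 8 * t) ≤ k} = ∅ := by
        ext k
        simp only [Set.mem_ofPred_eq, Set.mem_empty_iff_false, iff_false, not_and, not_le]
        intro h
        have : (k : ℝ) ≤ n := by exact_mod_cast h
        nlinarith
      rw [this]; simp [binMass]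
    have := hempty (by linarith)
    linarith
  · have hl := one_le_log_div hq0 hn h2
    set y := L / (n * q) with hy
    have hypos : 0 < y := by positivity
    have e : n * t * Real.log y = L := by
      rw [e]; field_simp
    have hlogy : Real.log y ≤ y := by linarith [Real.log_le_sub_one_of_pos hypos]
    -- From `log y ≤ y`; hence `q < 8 * t` and the lower tail is empty.
    have hqt : q ≤ t := by
      have h3 : n * q * y = L := by rw [hy]; field_simp
      have : n * q * Real.log y ≤ n * t * Real.log y := by
        rw [e, ← h3]; gcongr
      have := le_of_mul_le_mul_right this (by linarith)
      exact le_of_mul_le_mul_left this hn'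
    have hlow := hempty (by linarith)
    -- With tilt `log y` the mean term is at most `n * q * y = L`, while the threshold contributes
    -- at least `8 * n * t * log y = 8 * L`.
    have hup : binMass n q {k : ℕ | k ≤ n ∧ n * (q + 8 * t) ≤ k} ≤ Real.exp (-(3 * L)) := by
      refine le_trans ?_ (le_trans (binMass_chernoff (n := n) hq0.le hq1' (Real.log y) (n * (q + 8 * t)))
        (Real.exp_le_exp.2 ?_))
      · refine binMass_mono hq0.le hq1' fun k _ hk => ?_
        exact mul_le_mul_of_nonneg_left hk.2 (by linarith)
      · rw [Real.exp_log hypos]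
        have h3 : n * q * y = L := by rw [hy]; field_simp
        have : 0 ≤ n * q := by positivity
        nlinarith
    linarith
  · have hsq : t ^ 2 * n = q * L := by
      rw [e, Real.sq_sqrt (by positivity)]; field_simp
    -- This tilt gives `n * q * l ^ 2 = L / 4` and `8 * l * n * t = 4 * L`, so both exponents are at
    -- most `L / 4 - 4 * L`. The third regime ensures `l ≤ 1`, as the quadratic bound on `exp`
    -- requires.
    set l := √(L / (n * q)) / 2 with hl
    have hl2 : 4 * l ^ 2 * (n * q) = L := by
      rw [hl, div_pow, Real.sq_sqrt (by positivity)]; field_simp; ring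
    have hl0 : 0 < l := by positivity
    have hl1 : l ≤ 1 := by
      have he : Real.exp 1 < 3 := Real.exp_one_lt_three
      have hnq : 0 < n * q := by positivity
      have h3 : 4 * l ^ 2 < 3 := lt_of_mul_lt_mul_right (by nlinarith) hnq.le
      nlinarith
    have hlt : 2 * l * n * t = L := by
      have h3 : (2 * l * n * t) ^ 2 = L ^ 2 := by
        calc (2 * l * n * t) ^ 2 = 4 * l ^ 2 * n * (t ^ 2 * n) := by ring
          _ = 4 * l ^ 2 * (n * q) * L := by rw [hsq]; ring
          _ = L ^ 2 := by rw [hl2]; ring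
      exact (pow_left_inj₀ (by positivity) hL.le two_ne_zero).1 h3
    have hup : binMass n q {k : ℕ | k ≤ n ∧ n * (q + 8 * t) ≤ k} ≤ Real.exp (-(3 * L)) := by
      refine le_trans ?_ (le_trans (binMass_chernoff (n := n) hq0.le hq1' l (n * (q + 8 * t)))
        (Real.exp_le_exp.2 ?_))
      · refine binMass_mono hq0.le hq1' fun k _ hk => ?_
        exact mul_le_mul_of_nonneg_left hk.2 hl0.le
      · have h3 := (abs_le.1 (Real.abs_exp_sub_one_sub_id_le
          (abs_le.2 ⟨by linarith, hl1⟩ : |l| ≤ 1))).2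
        have h4 : n * q * (Real.exp l - 1 - l) ≤ n * q * l ^ 2 := by gcongr
        nlinarith
    have hlow : binMass n q {k : ℕ | (k : ℝ) ≤ n * (q - 8 * t)} ≤ Real.exp (-(3 * L)) := by
      refine le_trans ?_ (le_trans (binMass_chernoff (n := n) hq0.le hq1' (-l) (n * (q - 8 * t)))
        (Real.exp_le_exp.2 ?_))
      · refine binMass_mono hq0.le hq1' fun k _ hk => ?_
        have hk : (k : ℝ) ≤ n * (q - 8 * t) := hk
        simp only [Set.mem_ofPred_eq]
        nlinarith
      · have h3 := (abs_le.1 (Real.abs_exp_sub_one_sub_id_le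
          (abs_le.2 ⟨by linarith, by linarith⟩ : |-l| ≤ 1))).2
        have h4 : n * q * (Real.exp (-l) - 1 - -l) ≤ n * q * (-l) ^ 2 := by gcongr
        nlinarith
    linarith

/-! ### Anti-concentration for one coordinate -/

/-- The small-ball estimate at the scale `√(q / n)`. Passing to a larger parameter `q'` only spreads
the binomial more, since `√(n * q) ≤ √(n * q')`. -/
lemma binMass_dev_small {n : ℕ} {q q' f K : ℝ} (hq0 : 0 < q) (hq : q ≤ q') (hq1 : q' ≤ 1 / 2)
    (hn : 0 < n) (ht : 1 ≤ n * f) (hf : f ≤ K * √(q / n)) :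
    binMass n q' {k | |(k : ℝ) / n - q'| ≤ f} ≤ 12 * K := by
  have hn' : (0 : ℝ) < n := by exact_mod_cast hn
  have hq0' : 0 < q' := by linarith
  have hsub : binMass n q' {k | |(k : ℝ) / n - q'| ≤ f} ≤
      binMass n q' {k | |(k : ℝ) - n * q'| ≤ n * f} := by
    refine binMass_mono hq0'.le (by linarith) fun k _ hk => ?_
    have hk : |(k : ℝ) / n - q'| ≤ f := hk
    have e : (k : ℝ) - n * q' = n * ((k : ℝ) / n - q') := by field_simp
    simp only [Set.mem_ofPred_eq]
    rw [e, abs_mul, abs_of_pos hn']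
    gcongr
  refine hsub.trans ((binMass_abs_sub_le hq0' hq1 hn ht _).trans ?_)
  rw [div_le_iff₀ (Real.sqrt_pos.2 (by positivity))]
  have e : n * √(q / n) = √(n * q) := by
    rw [show (n : ℝ) * q = n ^ 2 * (q / n) by field_simp, Real.sqrt_mul (by positivity),
      Real.sqrt_sq hn'.le]
  have hs : √(n * q) ≤ √(n * q') := Real.sqrt_le_sqrt (by gcongr)
  have hK : 0 ≤ K := by
    by_contra h
    push Not at h
    have h1 : 0 < √(q / n) := Real.sqrt_pos.2 (by positivity)
    have h2 : f < 0 := hf.trans_lt (mul_neg_of_neg_of_pos h h1)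
    nlinarith
  calc 12 * (n * f) ≤ 12 * (n * (K * √(q / n))) := by gcongr
    _ = 12 * K * √(n * q) := by rw [← e]; ring
    _ ≤ _ := by gcongr

/-- Concentration around the mean above `q' + t`, at a parameter slightly larger than `q' + t`. -/
lemma half_le_binMass_of_tilt {n : ℕ} {q t : ℝ} (hq0 : 0 < q) (hn : 0 < n) (ht : 1 ≤ n * t)
    (hr : q + 5 * t + 4 * √(q / n) ≤ 1) :
    1 / 2 ≤ binMass n (q + 5 * t + 4 * √(q / n)) {k | t < (k : ℝ) / n - q} := by
  have hn' : (0 : ℝ) < n := by exact_mod_cast hn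
  have ht0 : 0 < t := by
    by_contra h
    nlinarith
  have hu0 : 0 < √(q / n) := Real.sqrt_pos.2 (by positivity)
  have hu2 : n * √(q / n) ^ 2 = q := by
    rw [Real.sq_sqrt (by positivity)]; field_simp
  set u := √(q / n)
  set r := q + 5 * t + 4 * u with hrdef
  have hr0 : 0 ≤ r := by positivity
  have hs : 0 < n * (4 * t + 4 * u) := by positivity
  have hc := binMass_lower_tail_le (n := n) hr0 hr hs
  have hle : n * r / (n * (4 * t + 4 * u)) ^ 2 ≤ 1 / 2 := by
    rw [div_le_iff₀ (by positivity)]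
    -- The threshold lies `4 * t + 4 * u` below the mean `r`. Expanding the square and using `1 ≤ n
    -- * t` and `n * u ^ 2 = q` gives at least `16 * t + 32 * u + 16 * q`.
    have h1 : 2 * r ≤ n * (4 * t + 4 * u) ^ 2 := by
      have : n * (4 * t + 4 * u) ^ 2 = 16 * (n * t) * t + 32 * (n * t) * u + 16 * q := by
        rw [← hu2]; ring
      rw [this, hrdef]
      have h2 : t ≤ n * t * t := by nlinarith
      have h3 : u ≤ n * t * u := by nlinarith
      nlinarith
    nlinarith
  have hcompl : binMass n r {k | t < (k : ℝ) / n - q}ᶜ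
      ≤ binMass n r {k | (k : ℝ) ≤ n * r - n * (4 * t + 4 * u)} := by
    refine binMass_mono hr0 hr fun k _ hk => ?_
    have hk : ¬ t < (k : ℝ) / n - q := hk
    have hk : (k : ℝ) / n ≤ q + t := by linarith
    rw [div_le_iff₀ hn'] at hk
    simp only [Set.mem_ofPred_eq]
    rw [hrdef]; linarith
  linarith [binMass_add_compl n r {k | t < (k : ℝ) / n - q}]

/-- The chi-square bound with `(5t + 4u)² ≤ 50t² + 32u²`, where `n * u ^ 2 = q` and `1 - q ≥ 1 / 2`:
the `t` part of the shift costs `100 * M`, the standard-deviation part only a constant. -/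
lemma bernoulliKL_tilt_le {n : ℕ} {q t M : ℝ} (hq0 : 0 < q) (hq1 : q ≤ 1 / 2) (hn : 0 < n)
    (ht0 : 0 < t) (hr : q + 5 * t + 4 * √(q / n) < 1) (hM : n * t ^ 2 ≤ M * q) :
    n * bernoulliKL (q + 5 * t + 4 * √(q / n)) q ≤ 100 * M + 64 := by
  have hn' : (0 : ℝ) < n := by exact_mod_cast hn
  have hu2 : n * √(q / n) ^ 2 = q := by
    rw [Real.sq_sqrt (by positivity)]; field_simp
  have hu0 := Real.sqrt_nonneg (q / n)
  set u := √(q / n)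
  have h := bernoulliKL_le_sq hq0 (by linarith) (by positivity : 0 < q + 5 * t + 4 * u) hr
  calc n * bernoulliKL (q + 5 * t + 4 * u) q
      ≤ n * ((q + 5 * t + 4 * u - q) ^ 2 / (q * (1 - q))) := by gcongr
    _ ≤ 100 * M + 64 := by
      rw [mul_div_assoc', div_le_iff₀ (by nlinarith)]
      have h1 : (q + 5 * t + 4 * u - q) ^ 2 ≤ 50 * t ^ 2 + 32 * u ^ 2 := by
        nlinarith [sq_nonneg (5 * t - 4 * u)]
      have h2 : n * (q + 5 * t + 4 * u - q) ^ 2 ≤ 50 * (M * q) + 32 * q := by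
        calc _ ≤ n * (50 * t ^ 2 + 32 * u ^ 2) := by gcongr
          _ = 50 * (n * t ^ 2) + 32 * (n * u ^ 2) := by ring
          _ ≤ _ := by rw [hu2]; linarith
      have hM0 : 0 ≤ M := by
        by_contra h
        have : 0 < n * t ^ 2 := by positivity
        nlinarith
      have h3 : (100 * M + 64) * q * (1 / 2) ≤ (100 * M + 64) * q * (1 - q) := by
        have : 0 ≤ (100 * M + 64) * q := by positivity
        nlinarith
      linarith

/-- Anti-concentration for one coordinate. -/
lemma binMass_near_le {J q q' : ℝ} {n : ℕ} (hJ : 0 < J) (hq0 : 0 < q) (hq : q ≤ q')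
    (hq1 : q' ≤ 1 / 2) (hn : 0 < n) (ht : 1 ≤ n * (1 / 1000 * phi J q n)) :
    binMass n q' {k | |(k : ℝ) / n - q'| ≤ 1 / 1000 * phi J q n} ≤ Real.exp (-(1 / J)) := by
  have hn' : (0 : ℝ) < n := by exact_mod_cast hn
  have hq0' : 0 < q' := by linarith
  rcases lt_or_ge J 1 with hJ1 | hJ1
  · have hphi : phi J q n = Real.exp (-(1 / J)) * √(q / n) := by
      unfold phi; rw [if_neg hq0.ne', if_pos hJ1, neg_div]
    have := binMass_dev_small (K := 1 / 1000 * Real.exp (-(1 / J))) hq0 hq hq1 hn ht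
      (by rw [hphi]; linarith)
    linarith [Real.exp_pos (-(1 / J))]
  have hL := log_add_one_pos hJ1
  -- Beyond this threshold `log J` absorbs the constants in the entropy cost. Below it, `phi` is at
  -- most `17 * √(q / n)` in the third regime, and otherwise `n * phi ≤ 526` contradicts `ht`.
  rcases lt_or_ge (Real.log J) 262 with hJ2 | hJ2
  · have hL2 : Real.log (J + 1) ≤ 263 := by
      have h1 : Real.log (J + 1) ≤ Real.log (J * 2) :=
        Real.log_le_log (by linarith) (by linarith)
      rw [Real.log_mul (by linarith) (by norm_num)] at h1
      linarith [Real.log_two_lt_d9]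
    by_cases h3 : phi J q n = √(q * Real.log (J + 1) / n)
    · have hle : 1 / 1000 * phi J q n ≤ 17 / 1000 * √(q / n) := by
        have : phi J q n ≤ 17 * √(q / n) := by
          rw [h3, show (17 : ℝ) = √(17 ^ 2) from (Real.sqrt_sq (by norm_num)).symm,
            ← Real.sqrt_mul (by norm_num)]
          apply Real.sqrt_le_sqrt
          rw [mul_div_assoc', div_le_div_iff_of_pos_right hn']
          nlinarith
        linarith
      have h4 := binMass_dev_small hq0 hq hq1 hn ht hle
      have h5 : Real.exp (-1) ≤ Real.exp (-(1 / J)) := by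
        apply Real.exp_le_exp.2
        have : 1 / J ≤ 1 := by rw [div_le_one hJ]; exact hJ1
        linarith
      have := Real.exp_neg_one_gt_d9
      linarith
    · have := (phi_mul_log_le hJ1 hq0 (hq.trans hq1) hn h3).2
      nlinarith
  · set f := phi J q n with hf
    have hf1 : f ≤ 1 := phi_le_one hJ hq0.le (hq.trans hq1) hn
    have hf0 : 0 < f := phi_pos hJ1 hq0 (hq.trans hq1) hn
    set t := 1 / 1000 * f with htdef
    have ht0 : 0 < t := by positivity
    have ht1 : t ≤ 1 / 1000 := by linarith
    have hu2 : n * √(q' / n) ^ 2 = q' := by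
      rw [Real.sq_sqrt (by positivity)]; field_simp
    have hu0 : 0 ≤ √(q' / n) := Real.sqrt_nonneg _
    have hu2t : √(q' / n) ^ 2 ≤ q' * t := by
      have : √(q' / n) ^ 2 ≤ n * t * √(q' / n) ^ 2 := by nlinarith [sq_nonneg √(q' / n)]
      nlinarith
    have hhalf := half_le_binMass_of_tilt hq0' hn ht
    have hKL := bernoulliKL_tilt_le (M := 1 / 1000 * Real.log (J + 1)) hq0' hq1 hn ht0
    set u := √(q' / n)
    have hu3 : u ≤ 1 / 40 := by nlinarith
    have hr : q' + 5 * t + 4 * u < 1 := by linarith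
    set L := Real.log (J + 1) with hLdef
    have hD : n * bernoulliKL (q' + 5 * t + 4 * u) q' ≤ 1 / 10 * L + 64 := by
      -- Either the chi-square bound suffices, or `t` is so large that the third regime is excluded.
      -- In that case `q' < 2 * t` and `r ≤ 13 * t ≤ f`, and the entropy is controlled by `f * log
      -- (f / q)`.
      rcases le_or_gt (n * t ^ 2) (1 / 1000 * L * q') with h | h
      · linarith [hKL hr h]
      · have h3 : f ≠ √(q * L / n) := by
          intro h3
          have : n * f ^ 2 = q * L := by
            rw [h3, Real.sq_sqrt (by positivity)]; field_simp
          have h4 : q * L ≤ q' * L := by gcongr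
          rw [htdef] at h
          nlinarith
        obtain ⟨h5, h6⟩ := phi_mul_log_le hJ1 hq0 (hq.trans hq1) hn h3
        have h7 : q' < 2 * t := by
          have h8 : n * f * t ≤ 2 * L * t := by gcongr
          have h9 : n * t ^ 2 = 1 / 1000 * (n * f * t) := by rw [htdef]; ring
          have h10 : L * q' < L * (2 * t) := by linarith
          exact lt_of_mul_lt_mul_left h10 hL.le
        have h11 : u ≤ 3 / 2 * t := by
          have : u ^ 2 ≤ 2 * t ^ 2 := by nlinarith
          nlinarith
        set r := q' + 5 * t + 4 * u with hrdef
        have hr13 : r ≤ 13 * t := by linarith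
        have hrf : r ≤ f := by linarith
        have hqr : q' ≤ r := by linarith
        have hr0 : 0 < r := by linarith
        have h12 := bernoulliKL_le_mul_log (by linarith : q' < 1) hqr hr
        have h13 : Real.log (r / q') ≤ Real.log (f / q) :=
          Real.log_le_log (by positivity) (by gcongr)
        have h14 : 0 ≤ Real.log (f / q) :=
          Real.log_nonneg (by rw [le_div_iff₀ hq0]; linarith)
        calc n * bernoulliKL r q' ≤ n * (r * Real.log (f / q)) := by
              gcongr; exact h12.trans (by gcongr)
          _ ≤ n * ((13 * t) * Real.log (f / q)) := by gcongr
          _ = 13 / 1000 * (n * (f * Real.log (f / q))) := by rw [htdef]; ring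
          _ ≤ 1 / 10 * L + 64 := by linarith
    have hlow := exp_le_binMass (n := n) hq0' (by linarith : q' < 1)
      (by linarith : 0 < q' + 5 * t + 4 * u) hr (hhalf hr.le)
    have hLJ : L ≤ Real.log J + 1 := by
      have h1 : Real.log (J + 1) ≤ Real.log (J * 2) :=
        Real.log_le_log (by linarith) (by linarith)
      rw [Real.log_mul (by linarith) (by norm_num)] at h1
      linarith [Real.log_two_lt_d9]
    -- The cost `2 * (L / 10 + 64) + 3` is at most `log J`. The complement then has mass at most `1
    -- - 1 / J ≤ exp (-1 / J)`.
    have hJinv : 1 / J ≤ binMass n q' {k | t < (k : ℝ) / n - q'} := by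
      refine le_trans ?_ hlow
      rw [one_div, ← Real.exp_log hJ, ← Real.exp_neg]
      apply Real.exp_le_exp.2
      linarith
    have hsub : binMass n q' {k | |(k : ℝ) / n - q'| ≤ t}
        ≤ binMass n q' {k | t < (k : ℝ) / n - q'}ᶜ := by
      refine binMass_mono hq0'.le (by linarith) fun k _ hk => ?_
      have hk : |(k : ℝ) / n - q'| ≤ t := hk
      exact not_lt.2 (le_of_abs_le hk)
    have := binMass_add_compl n q' {k | t < (k : ℝ) / n - q'}
    have := Real.add_one_le_exp (-(1 / J))
    linarith

/-! ### From samples to independent binomial counts -/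

/-- The number of points of the sample `x` whose `j`-th coordinate is `1`. -/
def count {n : ℕ} (x : Fin n → Bool) : ℕ := (Finset.univ.filter fun i => x i = true).card

lemma empMean_eq {n : ℕ} (x : Fin n → ℕ+ → Bool) (j : ℕ+) :
    empMean x j = (count fun i => x i j : ℝ) / n := by
  simp [empMean, count]

lemma binomial_real_eq {n : ℕ} (q : unitInterval) (A : Set ℕ) :
    (binomial n q).real A = binMass n q A := by
  have h1 : (binomial n q).real A = ∫ k, A.indicator (fun _ => (1 : ℝ)) k ∂(binomial n q) := by
    rw [integral_indicator (by measurability)]; simp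
  rw [h1, integral_binomial]
  have : Finset.Iic n = Finset.range (n + 1) := by ext; simp
  rw [this, binMass]
  refine Finset.sum_congr rfl fun k _ => ?_
  by_cases h : k ∈ A <;> simp [h, binWeight]

lemma card_count_eq (n k : ℕ) :
    (Finset.univ.filter fun x : Fin n → Bool => count x = k).card = n.choose k := by
  have h := Finset.card_powersetCard k (Finset.univ : Finset (Fin n))
  rw [Finset.card_univ, Fintype.card_fin] at h
  rw [← h]
  refine Finset.card_bij (fun x _ => Finset.univ.filter fun i => x i = true) ?_ ?_ ?_
  · intro x hx
    exact Finset.mem_powersetCard.2 ⟨Finset.subset_univ _, (Finset.mem_filter.1 hx).2⟩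
  · intro x _ y _ hxy
    funext i
    have := Finset.ext_iff.1 hxy i
    simp only [Finset.mem_filter, Finset.mem_univ, true_and] at this
    exact Bool.eq_iff_iff.2 this
  · intro s hs
    refine ⟨fun i => decide (i ∈ s), ?_, ?_⟩
    · rw [Finset.mem_filter, count]
      simpa using (Finset.mem_powersetCard.1 hs).2
    · ext i; simp

lemma pi_bernoulli_singleton {n : ℕ} (q : unitInterval) (x : Fin n → Bool) :
    (Measure.infinitePi fun _ : Fin n => bernoulliMeasure true false q).real {x}
      = (q : ℝ) ^ count x * (1 - q) ^ (n - count x) := by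
  rw [measureReal_def, Measure.infinitePi_singleton_of_fintype, ENNReal.toReal_prod]
  have : ∀ i, (bernoulliMeasure true false q {x i}).toReal
      = if x i = true then (q : ℝ) else 1 - q := by
    intro i
    rw [← measureReal_def, bernoulliMeasure_real_apply _ (by measurability)]
    cases x i <;> simp
  simp only [this]
  rw [Finset.prod_ite, Finset.prod_const, Finset.prod_const, count]
  congr 2
  have := Finset.card_filter_add_card_filter_not (s := (Finset.univ : Finset (Fin n)))
    (fun i => x i = true)
  simp at this ⊢
  omega

lemma map_count (n : ℕ) (q : unitInterval) :
    (Measure.infinitePi fun _ : Fin n => bernoulliMeasure true false q).map count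
      = binomial n q := by
  have : IsProbabilityMeasure
    ((Measure.infinitePi fun _ : Fin n => bernoulliMeasure true false q).map count) :=
    Measure.isProbabilityMeasure_map (Measurable.of_discrete.aemeasurable)
  refine Measure.ext_of_measureReal_singleton fun k => ?_
  rw [binomial_real_singleton, map_measureReal_apply .of_discrete (by measurability)]
  have : (count ⁻¹' {k} : Set (Fin n → Bool))
      = ↑(Finset.univ.filter fun x : Fin n → Bool => count x = k) := by ext; simp
  rw [this, ← sum_measureReal_singleton, Finset.sum_congr rfl (g := fun _ =>
    (q : ℝ) ^ k * (1 - q) ^ (n - k)), Finset.sum_const, card_count_eq]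
  · simp [mul_assoc]
  · intro x hx
    rw [pi_bernoulli_singleton, (Finset.mem_filter.1 hx).2]

/-- The joint law of the coordinate counts of a sample. -/
lemma IsSample.hasLaw_count {Ω : Type*} [MeasurableSpace Ω] {P : Measure Ω}
    {p : ℕ+ → unitInterval} {n : ℕ} {X : Fin n → Ω → ℕ+ → Bool} (h : IsSample P p X) :
    HasLaw (fun ω j => count fun i => X i ω j)
      (Measure.infinitePi fun j => binomial n (p j)) P := by
  have h1 : HasLaw (fun ω i => X i ω) (Measure.infinitePi fun _ : Fin n => bernoulliProduct p) P :=
    h.indep.hasLaw_infinitePi h.hasLaw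
      (aemeasurable_pi_lambda _ fun i => (h.hasLaw i).aemeasurable)
  -- Both iterated products are curried forms of one product over pairs, up to swapping the two
  -- indices.
  have h2 : HasLaw (fun (x : Fin n → ℕ+ → Bool) (j : ℕ+) (i : Fin n) => x i j)
      (Measure.infinitePi fun j => Measure.infinitePi fun _ : Fin n =>
        bernoulliMeasure true false (p j))
      (Measure.infinitePi fun _ : Fin n => bernoulliProduct p) := by
    refine ⟨(measurable_pi_lambda _ fun j => measurable_pi_lambda _ fun i =>
      (measurable_pi_apply j).comp (measurable_pi_apply i)).aemeasurable, ?_⟩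
    have e1 := Measure.infinitePi_map_curry (X := Bool)
      (fun (_ : Fin n) (j : ℕ+) => bernoulliMeasure true false (p j))
    have e2 := Measure.infinitePi_map_curry (X := Bool)
      (fun (j : ℕ+) (_ : Fin n) => bernoulliMeasure true false (p j))
    have e3 := Measure.infinitePi_map_piCongrLeft
      (fun z : ℕ+ × Fin n => bernoulliMeasure true false (p z.1)) (Equiv.prodComm (Fin n) ℕ+)
    unfold bernoulliProduct
    rw [← e1, ← e2, ← e3, Measure.map_map (by fun_prop) (by fun_prop),
      Measure.map_map (by fun_prop) (by fun_prop)]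
    rfl
  have h3 : HasLaw (fun (x : ℕ+ → Fin n → Bool) j => count (x j))
      (Measure.infinitePi fun j => binomial n (p j))
      (Measure.infinitePi fun j => Measure.infinitePi fun _ : Fin n =>
        bernoulliMeasure true false (p j)) := by
    refine ⟨(measurable_pi_lambda _ fun j =>
      (Measurable.of_discrete (f := count)).comp (measurable_pi_apply j)).aemeasurable, ?_⟩
    rw [Measure.infinitePi_map_pi _ (f := fun _ => count) (fun _ => .of_discrete)]
    simp only [map_count]
  exact h3.fun_comp (h2.fun_comp h1)

/-- The marginal law of a coordinate count. -/
lemma IsSample.measure_count {Ω : Type*} [MeasurableSpace Ω] {P : Measure Ω}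
    {p : ℕ+ → unitInterval} {n : ℕ} {X : Fin n → Ω → ℕ+ → Bool} (h : IsSample P p X) (j : ℕ+)
    (A : Set ℕ) :
    P {ω | (count fun i => X i ω j) ∈ A} = ENNReal.ofReal (binMass n (p j) A) := by
  have h1 : HasLaw (fun ω => count fun i => X i ω j) (binomial n (p j)) P :=
    (measurePreserving_eval_infinitePi (fun j => binomial n (p j)) j).fun_comp_hasLaw
      h.hasLaw_count
  rw [h1.measure_eq (p := fun k => k ∈ A) (by measurability), ← binomial_real_eq, ofReal_measureReal]
  rfl

/-! ### Bounded suprema and auxiliary estimates -/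

lemma count_le {n : ℕ} (x : Fin n → Bool) : count x ≤ n := by
  simpa [count] using Finset.card_filter_le (Finset.univ : Finset (Fin n)) fun i => x i = true

lemma empMean_nonneg {n : ℕ} (x : Fin n → ℕ+ → Bool) (j : ℕ+) : 0 ≤ empMean x j := by
  rw [empMean_eq]; positivity

lemma empMean_le_one {n : ℕ} (x : Fin n → ℕ+ → Bool) (j : ℕ+) : empMean x j ≤ 1 := by
  rw [empMean_eq]
  exact div_le_one_of_le₀ (by exact_mod_cast count_le _) (by positivity)

lemma abs_empMean_sub_le {n : ℕ} (x : Fin n → ℕ+ → Bool) (p : ℕ+ → unitInterval) (j : ℕ+) :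
    |empMean x j - p j| ≤ maxDev x p := by
  refine le_ciSup (f := fun j => |empMean x j - p j|) ⟨1, ?_⟩ j
  rintro _ ⟨i, rfl⟩
  have h1 := empMean_nonneg x i
  have h2 := empMean_le_one x i
  have h3 := (p i).2.1
  have h4 := (p i).2.2
  exact abs_le.2 ⟨by linarith, by linarith⟩

lemma empMean_le_iSup {n : ℕ} (x : Fin n → ℕ+ → Bool) (j : ℕ+) :
    empMean x j ≤ ⨆ j, empMean x j :=
  le_ciSup (f := empMean x) ⟨1, by rintro _ ⟨i, rfl⟩; exact empMean_le_one x i⟩ j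

lemma phi_le_iSup {n : ℕ} (hn : 0 < n) {g : ℝ} (hg : 0 < g) {p : ℕ+ → unitInterval}
    (hp : IsProfile p) (j : ℕ+) :
    phi (((j : ℕ) : ℝ) / g) (p j) n ≤ ⨆ j : ℕ+, phi (((j : ℕ) : ℝ) / g) (p j) n := by
  refine le_ciSup (f := fun j : ℕ+ => phi (((j : ℕ) : ℝ) / g) (p j) n) ⟨1, ?_⟩ j
  rintro _ ⟨i, rfl⟩
  have : (0 : ℝ) < (i : ℕ) := by exact_mod_cast i.pos
  exact phi_le_one (by positivity) (p i).2.1 (hp.2 i) hn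

lemma tsum_ofReal_div_sq_le {c : ℝ} (hc : 0 ≤ c) :
    ∑' j : ℕ+, ENNReal.ofReal (c / ((j : ℕ) : ℝ) ^ 2) ≤ ENNReal.ofReal (2 * c) := by
  have hs : HasSum (fun j : ℕ => c * (1 / (j : ℝ) ^ 2)) (c * (Real.pi ^ 2 / 6)) :=
    hasSum_zeta_two.mul_left c
  calc ∑' j : ℕ+, ENNReal.ofReal (c / ((j : ℕ) : ℝ) ^ 2)
      ≤ ∑' j : ℕ, ENNReal.ofReal (c / (j : ℝ) ^ 2) :=
        ENNReal.tsum_comp_le_tsum_of_injective PNat.coe_injective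
          (fun j : ℕ => ENNReal.ofReal (c / (j : ℝ) ^ 2))
    _ = ENNReal.ofReal (c * (Real.pi ^ 2 / 6)) := by
        rw [← hs.tsum_eq, ENNReal.ofReal_tsum_of_nonneg (fun j => by positivity) hs.summable]
        simp only [mul_one_div]
    _ ≤ ENNReal.ofReal (2 * c) := by
        apply ENNReal.ofReal_le_ofReal
        have h1 := Real.pi_lt_d2
        have h2 := Real.pi_pos
        have h3 : Real.pi ^ 2 / 6 ≤ 2 := by nlinarith
        nlinarith

lemma binMass_zero {n : ℕ} {A : Set ℕ} (hA : 0 ∉ A) : binMass n 0 A = 0 := by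
  refine Finset.sum_eq_zero fun k _ => ?_
  rcases Nat.eq_zero_or_pos k with rfl | hk
  · simp [hA]
  · refine Set.indicator_apply_eq_zero.2 fun _ => ?_
    simp [binWeight, hk.ne']

/-! ### The two bounds on the maximal deviation -/

section Sample

variable {Ω : Type*} [MeasurableSpace Ω] {P : Measure Ω} {p : ℕ+ → unitInterval} {n : ℕ}
  {X : Fin n → Ω → ℕ+ → Bool}

lemma measure_exists_count_le (h : IsSample P p X) (A : ℕ+ → Set ℕ) :
    P {ω | ∃ j, (count fun i => X i ω j) ∈ A j} ≤
      ∑' j, ENNReal.ofReal (binMass n (p j) (A j)) := by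
  rw [Set.ofPred_exists]
  refine (measure_iUnion_le _).trans (ENNReal.tsum_le_tsum fun j => ?_)
  exact (h.measure_count j (A j)).le

lemma measure_forall_count (h : IsSample P p X) (s : Finset ℕ+) (A : ℕ+ → Set ℕ) :
    P {ω | ∀ j ∈ s, (count fun i => X i ω j) ∈ A j} =
      ENNReal.ofReal (∏ j ∈ s, binMass n (p j) (A j)) := by
  have h1 := h.hasLaw_count.measure_eq (p := fun N => N ∈ Set.pi (s : Set ℕ+) A)
    (MeasurableSet.pi s.countable_toSet fun _ _ => by measurability)
  rw [ENNReal.ofReal_prod_of_nonneg fun j _ => binMass_nonneg (p j).2.1 (p j).2.2 _]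
  refine h1.trans ((Measure.infinitePi_pi _ fun _ _ => by measurability).trans ?_)
  refine Finset.prod_congr rfl fun j _ => ?_
  rw [← binomial_real_eq, ofReal_measureReal]

lemma measure_maxDev_ge_le (h : IsSample P p X) (hn : 0 < n) {γ : ℝ} (hγ0 : 0 < γ)
    (hγ1 : γ < 1 / 2) (hp : IsProfile p) (hpos : ∃ j, 0 < (p j : ℝ)) :
    P {ω | 16 * (⨆ j : ℕ+, phi (((j : ℕ) : ℝ) / γ) (p j) n) ≤ maxDev (fun i => X i ω) p}
      ≤ ENNReal.ofReal γ := by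
  set S := ⨆ j : ℕ+, phi (((j : ℕ) : ℝ) / γ) (p j) n with hS
  have hj1 : ∀ j : ℕ+, (1 : ℝ) ≤ (j : ℕ) := fun j => by exact_mod_cast j.pos
  have hJ : ∀ j : ℕ+, 1 ≤ ((j : ℕ) : ℝ) / γ := fun j => by
    rw [le_div_iff₀ hγ0]; linarith [hj1 j]
  have hSpos : 0 < S := by
    obtain ⟨j, hj⟩ := hpos
    exact (phi_pos (hJ j) hj (hp.2 j) hn).trans_le (phi_le_iSup hn hγ0 hp j)
  calc _ ≤ P {ω | ∃ j : ℕ+, (count fun i => X i ω j) ∈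
          {k : ℕ | 8 * phi (((j : ℕ) : ℝ) / γ) (p j) n < |(k : ℝ) / n - p j|}} := by
        refine measure_mono fun ω hω => ?_
        by_contra hcon
        simp only [Set.mem_ofPred_eq, not_exists, not_lt] at hω hcon
        -- The supremum need not be attained, so coordinatewise bounds give only `≤ 8 * S`; the
        -- constant 16 and `0 < S` make this a contradiction.
        have : maxDev (fun i => X i ω) p ≤ 8 * S := by
          refine ciSup_le fun j => ?_
          rw [empMean_eq]
          exact (hcon j).trans (by gcongr; exact phi_le_iSup hn hγ0 hp j)
        linarith
    _ ≤ _ := measure_exists_count_le h _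
    _ ≤ ∑' j : ℕ+, ENNReal.ofReal (2 * γ ^ 3 / ((j : ℕ) : ℝ) ^ 2) := by
        refine ENNReal.tsum_le_tsum fun j => ENNReal.ofReal_le_ofReal ?_
        rcases (p j).2.1.eq_or_lt with h0 | h0
        · rw [← h0, binMass_zero (by simp [phi])]
          positivity
        · refine (binMass_dev_le (hJ j) h0 (hp.2 j) hn).trans ?_
          have hJpos : 0 < ((j : ℕ) : ℝ) / γ := by linarith [hJ j]
          have e : Real.exp (-(3 * Real.log (((j : ℕ) : ℝ) / γ + 1)))
              = ((((j : ℕ) : ℝ) / γ + 1) ^ 3)⁻¹ := by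
            rw [Real.exp_neg, show (3 : ℝ) = ((3 : ℕ) : ℝ) by norm_num, Real.exp_nat_mul,
              Real.exp_log (by linarith)]
          rw [e]
          have h3 : ((((j : ℕ) : ℝ) / γ + 1) ^ 3)⁻¹ ≤ ((((j : ℕ) : ℝ) / γ) ^ 3)⁻¹ := by
            gcongr; linarith
          -- One power of `j` is discarded so that the series is bounded through `ζ(2)`.
          have h4 : ((((j : ℕ) : ℝ) / γ) ^ 3)⁻¹ ≤ γ ^ 3 / ((j : ℕ) : ℝ) ^ 2 := by
            rw [div_pow, inv_div]
            have := hj1 j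
            gcongr
            · norm_num
          rw [mul_div_assoc]
          linarith
    _ ≤ ENNReal.ofReal (2 * (2 * γ ^ 3)) := tsum_ofReal_div_sq_le (by positivity)
    _ ≤ ENNReal.ofReal γ := by
        apply ENNReal.ofReal_le_ofReal
        have : γ ^ 2 ≤ 1 / 4 := by nlinarith
        nlinarith

lemma measure_max_maxDev_le (h : IsSample P p X) (hn : 0 < n) {γ : ℝ} (hγ0 : 0 < γ)
    (hγ1 : γ < 1 / 2) (hp : IsProfile p) :
    P {ω | max (maxDev (fun i => X i ω) p) (1 / (n : ℝ))
        ≤ 1 / 2000 * (⨆ j : ℕ+, phi (((j : ℕ) : ℝ) / Real.log (1 / γ)) (p j) n)}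
      ≤ ENNReal.ofReal γ := by
  have hn' : (0 : ℝ) < n := by exact_mod_cast hn
  have hg : 0 < Real.log (1 / γ) := Real.log_pos (by rw [lt_div_iff₀ hγ0]; linarith)
  set g := Real.log (1 / γ) with hgdef
  set S := ⨆ j : ℕ+, phi (((j : ℕ) : ℝ) / g) (p j) n with hS
  -- The term `1 / n` in the maximum empties the event unless `S` is large, and largeness provides
  -- the resolution `1 ≤ n * t` needed for anti-concentration.
  rcases lt_or_ge (1 / 2000 * S) (1 / (n : ℝ)) with hlt | hge
  · have : {ω | max (maxDev (fun i => X i ω) p) (1 / (n : ℝ)) ≤ 1 / 2000 * S} = ∅ := by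
      ext ω
      simp only [Set.mem_ofPred_eq, Set.mem_empty_iff_false, iff_false, not_le]
      exact lt_max_of_lt_right hlt
    rw [this]; simp
  have hnpos : 0 < 1 / (n : ℝ) := by positivity
  -- Half of `S` is given up for a near-maximiser, which turns `1 / 2000` into `1 / 1000`.
  obtain ⟨j, hj⟩ := exists_lt_of_lt_ciSup (show S / 2 < S by linarith)
  have hjpos : (0 : ℝ) < (j : ℕ) := by exact_mod_cast j.pos
  have hJ : 0 < ((j : ℕ) : ℝ) / g := by positivity
  have hq0 : 0 < (p j : ℝ) := by
    rcases (p j).2.1.eq_or_lt with h0 | h0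
    · rw [← h0, phi_zero_right] at hj
      linarith
    · exact h0
  set f := phi (((j : ℕ) : ℝ) / g) (p j) n with hf
  have ht : 1 ≤ n * (1 / 1000 * f) := by
    have : 1 / (n : ℝ) ≤ 1 / 1000 * f := by linarith
    rw [div_le_iff₀ hn'] at this
    linarith
  calc _ ≤ P {ω | ∀ i ∈ Finset.Icc 1 j, (count fun l => X l ω i) ∈
          {k : ℕ | |(k : ℝ) / n - p i| ≤ 1 / 1000 * f}} := by
        refine measure_mono fun ω hω i _ => ?_
        have hω : max (maxDev (fun i => X i ω) p) (1 / (n : ℝ)) ≤ 1 / 2000 * S := hω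
        have h1 := abs_empMean_sub_le (fun i => X i ω) p i
        rw [empMean_eq] at h1
        have h2 := (le_max_left _ _).trans hω
        simp only [Set.mem_ofPred_eq]
        linarith
    _ = _ := measure_forall_count h _ _
    _ ≤ ENNReal.ofReal (∏ i ∈ Finset.Icc 1 j, Real.exp (-(1 / (((j : ℕ) : ℝ) / g)))) := by
        apply ENNReal.ofReal_le_ofReal
        refine Finset.prod_le_prod (fun i _ => binMass_nonneg (p i).2.1 (p i).2.2 _)
          fun i hi => ?_
        exact binMass_near_le hJ hq0 (hp.1 (Finset.mem_Icc.1 hi).2) (hp.2 i) hn ht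
    _ = ENNReal.ofReal γ := by
        rw [Finset.prod_const, PNat.card_Icc, ← Real.exp_nat_mul]
        congr 1
        have : (((j : ℕ) + 1 - ((1 : ℕ+) : ℕ) : ℕ) : ℝ) * -(1 / (((j : ℕ) : ℝ) / g)) = -g := by
          simp; field_simp
        rw [this, hgdef, one_div, Real.log_inv, neg_neg, Real.exp_log hγ0]

/-! ### The regime of small parameters -/

lemma binMass_one_le {n : ℕ} {q : ℝ} (h0 : 0 ≤ q) (h1 : q ≤ 1) :
    binMass n q {k | 1 ≤ k} ≤ n * q := by
  have := binMass_le_sum (n := n) h0 h1 (A := {k | 1 ≤ k}) (f := fun k => (k : ℝ))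
    (fun k => by positivity) (fun k hk => by exact_mod_cast hk)
  rwa [sum_mul_binWeight] at this

lemma binMass_two_le {n : ℕ} {q : ℝ} (h0 : 0 ≤ q) (h1 : q ≤ 1) :
    binMass n q {k | 2 ≤ k} ≤ (n * q) ^ 2 / 2 := by
  have := binMass_le_sum (n := n) h0 h1 (A := {k | 2 ≤ k}) (f := fun k => (k : ℝ) * (k - 1) / 2)
    (fun k => by
      rcases Nat.eq_zero_or_pos k with rfl | hk
      · simp
      · have : (1 : ℝ) ≤ k := by exact_mod_cast hk
        have : 0 ≤ (k : ℝ) - 1 := by linarith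
        positivity)
    (fun k hk => by
      have : (2 : ℝ) ≤ k := by exact_mod_cast hk
      nlinarith)
  refine this.trans ?_
  -- The second factorial moment, expanded in variance, mean and total mass.
  have e : ∀ k : ℕ, (k : ℝ) * (k - 1) / 2 * binWeight n q k =
      1 / 2 * ((n * q - k) ^ 2 * binWeight n q k) + (n * q - 1 / 2) * (k * binWeight n q k)
        - (n * q) ^ 2 / 2 * binWeight n q k := fun k => by ring
  simp only [e, Finset.sum_add_distrib, Finset.sum_sub_distrib, ← Finset.mul_sum,
    sum_sq_mul_binWeight, sum_mul_binWeight, sum_binWeight]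
  have : 0 ≤ n * q ^ 2 := by positivity
  nlinarith

lemma binMass_singleton_zero_le {n : ℕ} {q : ℝ} (h1 : q ≤ 1) :
    binMass n q {0} ≤ Real.exp (-(n * q)) := by
  have : binMass n q {0} = (1 - q) ^ n := by
    rw [binMass, Finset.sum_eq_single 0]
    · simp [binWeight]
    · intro k _ hk; simp [hk]
    · simp
  rw [this, show -(n * q) = n * -q by ring, Real.exp_nat_mul]
  exact pow_le_pow_left₀ (by linarith) (by linarith [Real.add_one_le_exp (-q)]) n

lemma two_div_le_iSup_empMean {n : ℕ} (hn : 0 < n) {x : Fin n → ℕ+ → Bool}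
    (h : 2 / (n : ℝ) ≤ ⨆ j, empMean x j) : ∃ j, 2 ≤ count fun i => x i j := by
  have hn' : (0 : ℝ) < n := by exact_mod_cast hn
  by_contra! hcon
  have : ⨆ j, empMean x j ≤ 1 / (n : ℝ) := by
    refine ciSup_le fun j => ?_
    rw [empMean_eq]
    gcongr
    exact_mod_cast Nat.lt_succ_iff.1 (hcon j)
  have : 2 / (n : ℝ) ≤ 1 / n := h.trans this
  rw [div_le_div_iff_of_pos_right hn'] at this
  norm_num at this

lemma exists_count_of_iSup_empMean_eq {n : ℕ} (hn : 0 < n) {x : Fin n → ℕ+ → Bool}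
    (h : ⨆ j, empMean x j = 1 / (n : ℝ)) : ∃ j, 1 ≤ count fun i => x i j := by
  have hn' : 0 < 1 / (n : ℝ) := by positivity
  by_contra! hcon
  have : ⨆ j, empMean x j ≤ 0 := by
    refine ciSup_le fun j => ?_
    rw [empMean_eq, Nat.lt_one_iff.1 (hcon j)]
    simp
  linarith

lemma iSup_empMean_eq {n : ℕ} {x : Fin n → ℕ+ → Bool}
    (h1 : ∃ j, 1 ≤ count fun i => x i j) (h2 : ∀ j, ¬ 2 ≤ count fun i => x i j) :
    ⨆ j, empMean x j = 1 / (n : ℝ) := by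
  apply le_antisymm
  · refine ciSup_le fun j => ?_
    rw [empMean_eq]
    gcongr
    exact_mod_cast Nat.lt_succ_iff.1 (not_le.1 (h2 j))
  · obtain ⟨j, hj⟩ := h1
    refine le_trans ?_ (empMean_le_iSup x j)
    rw [empMean_eq]
    gcongr
    exact_mod_cast hj

lemma measure_exists_two_le (h : IsSample P p X) (hn : 0 < n) {γ : ℝ} (hγ0 : 0 < γ)
    (hp : ∀ j : ℕ+, (p j : ℝ) ≤ γ / (2 * n * ((j : ℕ) : ℝ))) :
    P {ω | ∃ j, 2 ≤ count fun i => X i ω j} ≤ ENNReal.ofReal (γ ^ 2 / 4) := by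
  have hn' : (0 : ℝ) < n := by exact_mod_cast hn
  refine (measure_exists_count_le h fun _ => {k | 2 ≤ k}).trans ?_
  calc _ ≤ ∑' j : ℕ+, ENNReal.ofReal (γ ^ 2 / 8 / ((j : ℕ) : ℝ) ^ 2) := by
        refine ENNReal.tsum_le_tsum fun j => ENNReal.ofReal_le_ofReal ?_
        refine (binMass_two_le (p j).2.1 (p j).2.2).trans ?_
        have hj : (0 : ℝ) < (j : ℕ) := by exact_mod_cast j.pos
        have h0 := (p j).2.1
        have h1 : n * (p j : ℝ) ≤ γ / (2 * (j : ℕ)) := by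
          calc n * (p j : ℝ) ≤ n * (γ / (2 * n * ((j : ℕ) : ℝ))) := by gcongr; exact hp j
            _ = _ := by field_simp
        calc (n * (p j : ℝ)) ^ 2 / 2 ≤ (γ / (2 * (j : ℕ))) ^ 2 / 2 := by gcongr
          _ = _ := by field_simp; norm_num
    _ ≤ ENNReal.ofReal (2 * (γ ^ 2 / 8)) := tsum_ofReal_div_sq_le (by positivity)
    _ = _ := by congr 1; ring

/-- If `n * p j ≤ 1 / 4`, the second-order quantity `(n * p j) ^ 2 / 2` is at most an eighth of `n *
p j`. Together with the absolute bound of `measure_exists_two_le` this is compared with the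
probability of a positive count. -/
lemma measure_exists_two_le_tsum (h : IsSample P p X)
    (hp : ∀ j : ℕ+, n * (p j : ℝ) ≤ 1 / 4) :
    P {ω | ∃ j, 2 ≤ count fun i => X i ω j} ≤
      ENNReal.ofReal (1 / 8) * (n * ∑' j : ℕ+, ENNReal.ofReal (p j)) := by
  refine (measure_exists_count_le h fun _ => {k | 2 ≤ k}).trans ?_
  rw [← ENNReal.tsum_mul_left, ← ENNReal.tsum_mul_left]
  refine ENNReal.tsum_le_tsum fun j => ?_
  have h0 := (p j).2.1
  rw [← ENNReal.ofReal_natCast n, ← ENNReal.ofReal_mul (by positivity),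
    ← ENNReal.ofReal_mul (by norm_num)]
  refine ENNReal.ofReal_le_ofReal ((binMass_two_le (p j).2.1 (p j).2.2).trans ?_)
  have : 0 ≤ n * (p j : ℝ) := by positivity
  nlinarith [hp j]

lemma measure_exists_one_le (h : IsSample P p X) :
    P {ω | ∃ j, 1 ≤ count fun i => X i ω j} ≤ n * ∑' j : ℕ+, ENNReal.ofReal (p j) := by
  refine (measure_exists_count_le h fun _ => {k | 1 ≤ k}).trans ?_
  rw [← ENNReal.tsum_mul_left]
  refine ENNReal.tsum_le_tsum fun j => ?_
  rw [← ENNReal.ofReal_natCast n, ← ENNReal.ofReal_mul (by positivity)]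
  exact ENNReal.ofReal_le_ofReal (binMass_one_le (p j).2.1 (p j).2.2)

lemma half_min_le {y : ℝ} (hy : 0 ≤ y) : 1 / 2 * min 1 y ≤ 1 - Real.exp (-y) := by
  rcases le_total y 1 with h | h
  · rw [min_eq_right h]
    have h1 : Real.exp (-y) ≤ (1 + y)⁻¹ := by
      rw [Real.exp_neg]
      gcongr
      linarith [Real.add_one_le_exp y]
    have h2 : (1 + y)⁻¹ ≤ 1 - 1 / 2 * y := by
      rw [inv_le_iff_one_le_mul₀ (by linarith)]
      nlinarith
    linarith
  · rw [min_eq_left h]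
    have : Real.exp (-y) ≤ Real.exp (-1) := Real.exp_le_exp.2 (by linarith)
    linarith [Real.exp_neg_one_lt_d9]

/-- By independence, all counts over a finite set `s` vanish with probability at most `exp (-n * ∑ p
j)`. Taking the supremum over `s` at the end also covers a divergent series. -/
lemma half_min_le_measure_exists_one [IsProbabilityMeasure P] (h : IsSample P p X) :
    ENNReal.ofReal (1 / 2) * min 1 (n * ∑' j : ℕ+, ENNReal.ofReal (p j)) ≤
      P {ω | ∃ j, 1 ≤ count fun i => X i ω j} := by
  rw [ENNReal.tsum_eq_iSup_sum, ENNReal.mul_iSup, inf_iSup_eq, ENNReal.mul_iSup]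
  refine iSup_le fun s => ?_
  set y : ℝ := n * ∑ j ∈ s, (p j : ℝ) with hy
  have hs0 : 0 ≤ ∑ j ∈ s, (p j : ℝ) := Finset.sum_nonneg fun j _ => (p j).2.1
  have hy0 : 0 ≤ y := by positivity
  have hz : P {ω | ∀ j ∈ s, (count fun i => X i ω j) ∈ ({0} : Set ℕ)}
      ≤ ENNReal.ofReal (Real.exp (-y)) := by
    rw [measure_forall_count h s fun _ => {0}]
    apply ENNReal.ofReal_le_ofReal
    calc _ ≤ ∏ j ∈ s, Real.exp (-(n * (p j : ℝ))) :=
          Finset.prod_le_prod (fun j _ => binMass_nonneg (p j).2.1 (p j).2.2 _)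
            fun j _ => binMass_singleton_zero_le (p j).2.2
      _ = _ := by rw [← Real.exp_sum, Finset.sum_neg_distrib, ← Finset.mul_sum]
  have h1 : (1 : ENNReal) ≤ P {ω | ∃ j, 1 ≤ count fun i => X i ω j}
      + ENNReal.ofReal (Real.exp (-y)) := by
    calc (1 : ENNReal) = P Set.univ := measure_univ.symm
      _ ≤ P ({ω | ∃ j, 1 ≤ count fun i => X i ω j} ∪
            {ω | ∀ j ∈ s, (count fun i => X i ω j) ∈ ({0} : Set ℕ)}) := by
          refine measure_mono fun ω _ => ?_
          by_cases hω : ∃ j, 1 ≤ count fun i => X i ω j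
          · exact Or.inl hω
          · right
            intro j _
            push Not at hω
            exact Nat.lt_one_iff.1 (hω j)
      _ ≤ _ := (measure_union_le _ _).trans (by gcongr)
  have e : (n : ENNReal) * ∑ j ∈ s, ENNReal.ofReal (p j) = ENNReal.ofReal y := by
    rw [hy, ENNReal.ofReal_mul (by positivity), ENNReal.ofReal_natCast,
      ENNReal.ofReal_sum_of_nonneg fun j _ => (p j).2.1]
  have e2 : min 1 (ENNReal.ofReal y) = ENNReal.ofReal (min 1 y) := by
    rw [ENNReal.ofReal_min, ENNReal.ofReal_one]
  rw [e, e2, ← ENNReal.ofReal_mul (by norm_num)]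
  calc _ ≤ ENNReal.ofReal (1 - Real.exp (-y)) := ENNReal.ofReal_le_ofReal (half_min_le hy0)
    _ = 1 - ENNReal.ofReal (Real.exp (-y)) := by
        rw [ENNReal.ofReal_sub _ (Real.exp_pos _).le, ENNReal.ofReal_one]
    _ ≤ _ := tsub_le_iff_right.2 h1

end Sample

end LocalGC

/-! ### Assembly of the constants -/

open LocalGC in
theorem proposition8 :
    ∃ a₁ a₂ c C : ℝ, 0 < a₁ ∧ 0 < a₂ ∧ 0 < c ∧ 0 < C ∧
      ∀ (Ω : Type*) [MeasurableSpace Ω] (P : Measure Ω) [IsProbabilityMeasure P]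
        (n : ℕ) (_ : 1 ≤ n) (γ : ℝ) (_ : 0 < γ) (_ : γ < 1 / 2)
        (p : ℕ+ → unitInterval) (_ : LocalGC.IsProfile p)
        (X : Fin n → Ω → ℕ+ → Bool) (_ : LocalGC.IsSample P p X),
        ((∃ j : ℕ+, γ / (2 * n * ((j : ℕ) : ℝ)) ≤ (p j : ℝ)) →
          P {ω | a₁ * (⨆ j : ℕ+, LocalGC.phi (((j : ℕ) : ℝ) / γ) (p j) n)
                  ≤ LocalGC.maxDev (fun i => X i ω) p} ≤ ENNReal.ofReal γ ∧
          P {ω | max (LocalGC.maxDev (fun i => X i ω) p) (1 / (n : ℝ))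
                  ≤ a₂ * (⨆ j : ℕ+, LocalGC.phi (((j : ℕ) : ℝ) / Real.log (1 / γ)) (p j) n)}
            ≤ ENNReal.ofReal γ) ∧
        ((∀ j : ℕ+, (p j : ℝ) ≤ γ / (2 * n * ((j : ℕ) : ℝ))) →
          P {ω | 2 / (n : ℝ) ≤ (⨆ j : ℕ+, LocalGC.empMean (fun i => X i ω) j)}
            ≤ ENNReal.ofReal γ ∧
          ENNReal.ofReal c * min 1 (n * ∑' j : ℕ+, ENNReal.ofReal (p j))
            ≤ P {ω | (⨆ j : ℕ+, LocalGC.empMean (fun i => X i ω) j) = 1 / (n : ℝ)} ∧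
          P {ω | (⨆ j : ℕ+, LocalGC.empMean (fun i => X i ω) j) = 1 / (n : ℝ)}
            ≤ ENNReal.ofReal C * min 1 (n * ∑' j : ℕ+, ENNReal.ofReal (p j))) := by
  refine ⟨16, 1 / 2000, 1 / 4, 1, by norm_num, by norm_num, by norm_num, by norm_num, ?_⟩
  intro Ω _ P _ n hn γ hγ0 hγ1 p hp X hX
  have hn0 : 0 < n := hn
  have hn' : (1 : ℝ) ≤ n := by exact_mod_cast hn
  refine ⟨fun ⟨j, hj⟩ => ⟨?_, measure_max_maxDev_le hX hn0 hγ0 hγ1 hp⟩, fun hsmall => ?_⟩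
  · refine measure_maxDev_ge_le hX hn0 hγ0 hγ1 hp ⟨j, lt_of_lt_of_le ?_ hj⟩
    have : (0 : ℝ) < (j : ℕ) := by exact_mod_cast j.pos
    positivity
  have htwo := measure_exists_two_le hX hn0 hγ0 hsmall
  refine ⟨?_, ?_, ?_⟩
  · refine le_trans (measure_mono fun ω hω => two_div_le_iSup_empMean hn0 hω)
      (htwo.trans (ENNReal.ofReal_le_ofReal ?_))
    nlinarith
  · have hnp : ∀ j : ℕ+, n * (p j : ℝ) ≤ 1 / 4 := fun j => by
      have hj : (1 : ℝ) ≤ (j : ℕ) := by exact_mod_cast j.pos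
      have := hsmall j
      rw [le_div_iff₀ (by positivity)] at this
      have h0 : 0 ≤ n * (p j : ℝ) := mul_nonneg (by positivity) (p j).2.1
      nlinarith
    have h1 := half_min_le_measure_exists_one hX
    have h2 := measure_exists_two_le_tsum hX hnp
    set x := (n : ENNReal) * ∑' j : ℕ+, ENNReal.ofReal (p j)
    -- For `1 ≤ x` the absolute bound `γ ^ 2 / 4 ≤ 1 / 16` is used, otherwise the bound linear in
    -- `x`. Since `1 / 4 + 1 / 8 ≤ 1 / 2`, the constant `1 / 4` survives the subtraction.
    have h3 : P {ω | ∃ j, 2 ≤ count fun i => X i ω j} ≤ ENNReal.ofReal (1 / 8) * min 1 x := by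
      rcases le_total 1 x with hx | hx
      · rw [min_eq_left hx, mul_one]
        exact htwo.trans (ENNReal.ofReal_le_ofReal (by nlinarith))
      · rwa [min_eq_right hx]
    have h4 : P {ω | ∃ j, 1 ≤ count fun i => X i ω j} ≤
        P {ω | (⨆ j : ℕ+, empMean (fun i => X i ω) j) = 1 / (n : ℝ)}
          + P {ω | ∃ j, 2 ≤ count fun i => X i ω j} := by
      refine le_trans (measure_mono fun ω hω => ?_) (measure_union_le _ _)
      by_cases hω2 : ∃ j, 2 ≤ count fun i => X i ω j
      · exact Or.inr hω2
      · exact Or.inl (iSup_empMean_eq hω (not_exists.1 hω2))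
    have h5 : ENNReal.ofReal (1 / 4) * min 1 x + ENNReal.ofReal (1 / 8) * min 1 x
        ≤ ENNReal.ofReal (1 / 2) * min 1 x := by
      rw [← add_mul, ← ENNReal.ofReal_add (by norm_num) (by norm_num)]
      gcongr
      norm_num
    have hfin : ENNReal.ofReal (1 / 8) * min 1 x ≠ ⊤ :=
      ENNReal.mul_ne_top ENNReal.ofReal_ne_top (ne_top_of_le_ne_top ENNReal.one_ne_top
        (min_le_left _ _))
    exact (ENNReal.add_le_add_iff_right hfin).1 (h5.trans (h1.trans (h4.trans (by gcongr))))
  · rw [ENNReal.ofReal_one, one_mul]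
    refine le_min prob_le_one ?_
    exact le_trans (measure_mono fun ω hω => exists_count_of_iSup_empMean_eq hn0 hω)
      (measure_exists_one_le hX)
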